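/- All vector spaces are over $\mathbb{C}$. Let $V=(V,Y,\mathbf 1,\omega)$ be a vertex operator algebra with weight spaces $V_{(n)}=\{v : L(0)v=nv\}$, $n\in\mathbb{Z}$ (finite-dimensional, zero for $n$ sufficiently negative). Assume that $V$ is of CFT type ($V_{(n)}=0$ for $n<0$ and $V_{(0)}=\mathbb{C}\mathbf 1$) and $C_2$-cofinite, i.e. $C_2(V)=\operatorname{span}\{\operatorname{Res}_x x^{-2}Y(u,x)v : u,v\in V\}$ has finite codimension in $V$. Let $g$ be any automorphism of $V$ (not necessarily of finite order or semisimple). Write $g=e^{2\pi i\mathcal L}$ with $\mathcal L=\mathcal S+\mathcal N$, where $\mathcal S$ and $\mathcal N$ preserve the weight spaces and commute, $\mathcal S$ is semisimple with eigenvalues whose real parts lie in $[0,1)$, and $\mathcal N$ is nilpotent on each weight space; put $V^{[\alpha]}=\{v\in V:\mathcal S v=\alpha v\}$. A weak $g$-twisted $V$-module is a vector space $W$ with a linear map $$Y_W:V\to(\operatorname{End}W)\{x\}[\log x],\qquad Y_W(u,x)=\sum_{k=0}^{K}\sum_{n\in\mathbb{C}}u(n,k)\,x^{-n-1}(\log x)^k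 ,$$ such that: (1) for all $u\in V$, $w\in W$, $n\in\mathbb{C}$, $k\ge 0$ one has $u(n+l,k)w=0$ for all sufficiently large $l\in\mathbb{Z}$; (2) $Y_W(\mathbf 1,x)=\mathrm{id}_W$; (3) for all $u,v\in V$, $$x_0^{-1}\delta\!\left(\tfrac{x_1-x_2}{x_0}\right)Y_W(u,x_1)Y_W(v,x_2)-x_0^{-1}\delta\!\left(\tfrac{-x_2+x_1}{x_0}\right)Y_W(v,x_2)Y_W(u,x_1)=x_1^{-1}\delta\!\left(\tfrac{x_2+x_0}{x_1}\right)Y_W\!\left(Y\!\left(\left(\tfrac{x_2+x_0}{x_1}\right)^{\mathcal L}u,x_0\right)v,x_2\right);$$ (4) $e^{2\pi i x\frac{d}{dx}}Y_W(gu,x)=Y_W(u,x)$ for all $u\in V$, where $e^{2\pi i x\frac{d}{dx}}$ sends $x^{n}(\log x)^k$ to $e^{2\pi i n}x^{n}(\log x+2\pi i)^k$. Write $u(n)=u(n,0)$. Let $W$ be a weak $g$-twisted $V$-module generated by a vector $\mathsf w$, i.e. $W=E\mathsf w$, where $E\subseteq\operatorname{End}W$ is the algebra generated by all the coefficients $u(n,k)$.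 Let $\{b_i\}_{i\in I}$ be representatives in $V$ of a basis of $V/C_2(V)$, each homogeneous both for the weight and for $\mathcal S$, and let $\alpha_i$ be the $\mathcal S$-eigenvalue of $b_i$. Let $B$ be the set of those $b_i$ that are not multiples of $\mathbf 1$. Let $L\in\mathbb{Z}$ be such that $b_i(\alpha_i-n)\mathsf w=0$ for all $b_i\in B$ and all integers $n\le L$. Let $M\in\mathbb{Z}_{\ge 0}$ be such that $V_{(n)}\subseteq C_2(V)$ for all $n\ge M$. Then for every integer $N\ge L$, the space $W$ is spanned by the elements $$b_{i_1}(\alpha_{i_1}-n_1)\cdots b_{i_k}(\alpha_{i_k}-n_k)\,\mathsf w$$ with $k\in\mathbb{Z}_{\ge 0}$, $b_{i_1},\dots,b_{i_k}\in B$ and integers $n_1,\dots,n_k>L$ such that (i) $n_1\ge\cdots\ge n_k$; and (ii) every integer $n\le N$ occurs at most $M$ times among $n_1,\dots,n_k$. -/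

import Mathlib

noncomputable section

/-! ### Logarithms of locally finite operators -/

namespace LocFinLog

variable {V : Type*} [AddCommGroup V] [Module ℂ V]

/-- The unique `α` with `0 ≤ Re α < 1` and `exp (2πiα) = μ` (for `μ ≠ 0`). -/
def stripLog (μ : ℂ) : ℂ :=
  Complex.log μ / (2 * Real.pi * Complex.I) -
    (⌊(Complex.log μ / (2 * Real.pi * Complex.I)).re⌋ : ℂ)

/-- `V` is the direct sum of the generalized eigenspaces of `f`. -/
theorem bijective_coeLinearMap {f : Module.End ℂ V} (hf : ⨆ μ, f.maxGenEigenspace μ = ⊤) :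
    Function.Bijective (DirectSum.coeLinearMap f.maxGenEigenspace) :=
  DirectSum.isInternal_submodule_of_iSupIndep_of_iSup_eq_top
    (Module.End.independent_maxGenEigenspace f) hf

/-- The linear map `V → V` that is `φ μ` on the generalized `μ`-eigenspace of `f`. -/
def glue {f : Module.End ℂ V} (hf : ⨆ μ, f.maxGenEigenspace μ = ⊤)
    (φ : ∀ μ, f.maxGenEigenspace μ →ₗ[ℂ] V) : Module.End ℂ V :=
  (DirectSum.toModule ℂ ℂ V φ) ∘ₗ
    (LinearEquiv.ofBijective (DirectSum.coeLinearMap f.maxGenEigenspace)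
      (bijective_coeLinearMap hf)).symm.toLinearMap

theorem glue_apply {f : Module.End ℂ V} (hf : ⨆ μ, f.maxGenEigenspace μ = ⊤)
    (φ : ∀ μ, f.maxGenEigenspace μ →ₗ[ℂ] V) (μ : ℂ) (v : f.maxGenEigenspace μ) :
    glue hf φ (v : V) = φ μ v := by
  have h : (LinearEquiv.ofBijective (DirectSum.coeLinearMap f.maxGenEigenspace)
      (bijective_coeLinearMap hf)).symm (v : V) =
      DirectSum.lof ℂ ℂ (fun μ => f.maxGenEigenspace μ) μ v := by
    rw [LinearEquiv.symm_apply_eq, LinearEquiv.ofBijective_apply]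
    exact (DirectSum.coeLinearMap_lof _ μ v).symm
  simp only [glue, LinearMap.comp_apply, LinearEquiv.coe_coe]
  rw [h, DirectSum.toModule_lof]

/-- The logarithm series of the locally unipotent operator `μ⁻¹ f` on the generalized
`μ`-eigenspace of `f`, divided by `2πi`. -/
def unipotentLog (f : Module.End ℂ V) (μ : ℂ) : f.maxGenEigenspace μ →ₗ[ℂ] V where
  toFun v := (2 * Real.pi * Complex.I : ℂ)⁻¹ •
    ∑ᶠ k : ℕ, ((-1 : ℂ) ^ k / (k + 1)) • ((μ⁻¹ • (f - μ • 1)) ^ (k + 1)) (v : V)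
  map_add' v w := by
    have fin : ∀ v : f.maxGenEigenspace μ, (Function.support fun k : ℕ =>
        ((-1 : ℂ) ^ k / (k + 1)) • ((μ⁻¹ • (f - μ • 1)) ^ (k + 1)) (v : V)).Finite := by
      rintro ⟨v, hv⟩
      obtain ⟨K, hK⟩ := (Module.End.mem_maxGenEigenspace f μ v).1 hv
      refine (Set.finite_lt_nat K).subset fun k hk => ?_
      by_contra hlt
      apply hk
      have hle : K ≤ k + 1 := by
        simp only [Set.mem_ofPred_eq, not_lt] at hlt
        omega
      obtain ⟨d, hd⟩ := Nat.exists_eq_add_of_le hle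
      have : ((f - μ • (1 : Module.End ℂ V)) ^ (k + 1)) v = 0 := by
        rw [hd, add_comm, pow_add, Module.End.mul_apply, hK, map_zero]
      simp [smul_pow, this]
    rw [← smul_add, ← finsum_add_distrib (fin v) (fin w)]
    simp [smul_add]
  map_smul' c v := by
    rw [RingHom.id_apply, smul_comm c]
    congr 1
    rw [smul_finsum]
    refine finsum_congr fun k => ?_
    rw [Submodule.coe_smul, map_smul, smul_comm c]

/-- The semisimple part `𝓢` of `𝓛 = log f / (2πi)`: it acts on the generalized `μ`-eigenspace of `f`
as the scalar `α` with `0 ≤ Re α < 1`, `exp (2πiα) = μ`. -/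
def semisimplePart {f : Module.End ℂ V} (hf : ⨆ μ, f.maxGenEigenspace μ = ⊤) : Module.End ℂ V :=
  glue hf fun μ => stripLog μ • (f.maxGenEigenspace μ).subtype

/-- The locally nilpotent part `𝓝` of `𝓛 = log f / (2πi)`. -/
def nilpotentPart {f : Module.End ℂ V} (hf : ⨆ μ, f.maxGenEigenspace μ = ⊤) : Module.End ℂ V :=
  glue hf (unipotentLog f)

/-- A finite-dimensional invariant subspace lies in the sum of the generalized eigenspaces. -/
theorem le_iSup_maxGenEigenspace (f : Module.End ℂ V) (p : Submodule ℂ V)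
    [FiniteDimensional ℂ p] (hp : Set.MapsTo f p p) : p ≤ ⨆ μ, f.maxGenEigenspace μ := by
  have h := Module.End.iSup_maxGenEigenspace_eq_top (LinearMap.restrict f hp : Module.End ℂ p)
  have h2 : p = (⨆ μ, Module.End.maxGenEigenspace (LinearMap.restrict f hp) μ).map p.subtype := by
    rw [h, Submodule.map_top, Submodule.range_subtype]
  rw [h2, Submodule.map_iSup]
  refine iSup_mono fun μ => ?_
  rintro _ ⟨x, hx, rfl⟩
  obtain ⟨k, hk⟩ := (Module.End.mem_maxGenEigenspace _ _ _).1 hx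
  refine (Module.End.mem_maxGenEigenspace _ _ _).2 ⟨k, ?_⟩
  have key : ∀ (k : ℕ) (x : p), ((f - μ • 1) ^ k) (x : V) =
      ((((LinearMap.restrict f hp : Module.End ℂ p) - μ • 1) ^ k) x : p) := by
    intro k
    induction k with
    | zero => intro x; simp
    | succ k ih =>
      intro x
      rw [pow_succ, pow_succ, Module.End.mul_apply, Module.End.mul_apply, ← ih]
      simp only [LinearMap.sub_apply, LinearMap.smul_apply, Module.End.one_apply,
        Submodule.coe_sub, Submodule.coe_smul, map_sub]
      rfl
  have := key k x
  rw [hk] at this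
  simpa using this

end LocFinLog

/-- The binomial coefficient `T (T - 1) ⋯ (T - j + 1) / j!` of an operator `T`. -/
def opChoose {V : Type*} [AddCommGroup V] [Module ℂ V] (T : Module.End ℂ V) (j : ℕ) :
    Module.End ℂ V :=
  ((Nat.factorial j : ℂ)⁻¹) • Polynomial.aeval T (descPochhammer ℂ j)

/-! ### Vertex operator algebras -/

open VertexOperator in
/-- A vertex operator algebra `(V, Y, 𝟏, ω)` over `ℂ`. The map `Y` sends `u` to
`Y(u,x) = ∑ₙ uₙ x⁻ⁿ⁻¹` (lower truncated when applied to a vector), and `ncoeff (Y u) n` is `uₙ`.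
The weight spaces are the eigenspaces of `L(0) = ω₁`. -/
structure VertexOperatorAlgebra (V : Type*) [AddCommGroup V] [Module ℂ V] where
  /-- the vertex operator map -/
  Y : V →ₗ[ℂ] VertexOperator ℂ V
  /-- the vacuum vector `𝟏` -/
  vacuum : V
  /-- the conformal vector `ω` -/
  conformal : V
  /-- the central charge -/
  charge : ℂ
  /-- `Y(𝟏,x) = id` -/
  vacuum_mode : ∀ n : ℤ, ncoeff (Y vacuum) n = if n = -1 then 1 else 0
  /-- `Y(v,x)𝟏` has no negative powers of `x` -/
  creation_reg : ∀ (v : V) (n : ℤ), 0 ≤ n → ncoeff (Y v) n vacuum = 0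
  /-- the constant term of `Y(v,x)𝟏` is `v` -/
  creation : ∀ v : V, ncoeff (Y v) (-1) vacuum = v
  /-- The Jacobi identity
  `x₀⁻¹δ((x₁-x₂)/x₀)Y(u,x₁)Y(v,x₂) - x₀⁻¹δ((-x₂+x₁)/x₀)Y(v,x₂)Y(u,x₁)`
  `= x₁⁻¹δ((x₂+x₀)/x₁)Y(Y(u,x₀)v,x₂)`,
  as the equality of the coefficients of `x₀⁻ˡ⁻¹ x₁⁻ᵐ⁻¹ x₂⁻ⁿ⁻¹` (all sums are finite). -/
  jacobi : ∀ (u v w : V) (l m n : ℤ),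
    (∑ᶠ i : ℕ, ((-1 : ℂ) ^ i * (Ring.choose l i : ℤ)) •
        ncoeff (Y u) (l + m - i) (ncoeff (Y v) (n + i) w)) -
      (∑ᶠ i : ℕ, ((-1 : ℂ) ^ (l - i : ℤ) * (Ring.choose l i : ℤ)) •
        ncoeff (Y v) (l + n - i) (ncoeff (Y u) (m + i) w)) =
    ∑ᶠ i : ℕ, ((Ring.choose m i : ℤ) : ℂ) • ncoeff (Y (ncoeff (Y u) (l + i) v)) (m + n - i) w
  /-- The Virasoro relations for `L(n) = ωₙ₊₁` -/
  virasoro : ∀ m n : ℤ,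
    ncoeff (Y conformal) (m + 1) * ncoeff (Y conformal) (n + 1) -
      ncoeff (Y conformal) (n + 1) * ncoeff (Y conformal) (m + 1) =
    ((m - n : ℤ) : ℂ) • ncoeff (Y conformal) (m + n + 1) +
      (if m + n = 0 then (((m : ℂ) ^ 3 - m) / 12) * charge else 0) • (1 : Module.End ℂ V)
  /-- `Y(L(-1)u,x) = d/dx Y(u,x)` -/
  derivative : ∀ (u : V) (n : ℤ),
    ncoeff (Y (ncoeff (Y conformal) 0 u)) n = (-n : ℂ) • ncoeff (Y u) (n - 1)
  /-- `V` is the sum of its weight spaces with integral weights -/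
  grading : ⨆ n : ℤ, (ncoeff (Y conformal) 1).eigenspace (n : ℂ) = ⊤
  /-- the weight spaces are finite-dimensional -/
  weight_finite : ∀ n : ℤ, FiniteDimensional ℂ ((ncoeff (Y conformal) 1).eigenspace (n : ℂ))
  /-- the weights are bounded below -/
  weight_bounded : ∃ n₀ : ℤ, ∀ n < n₀, (ncoeff (Y conformal) 1).eigenspace (n : ℂ) = ⊥
  /-- `ω` has weight two -/
  conformal_weight : ncoeff (Y conformal) 1 conformal = (2 : ℂ) • conformal

namespace VertexOperatorAlgebra

variable {V : Type*} [AddCommGroup V] [Module ℂ V] (A : VertexOperatorAlgebra V)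

/-- The mode `uₙ` of `Y(u,x) = ∑ₙ uₙ x⁻ⁿ⁻¹`. -/
def mode (u : V) (n : ℤ) : Module.End ℂ V := VertexOperator.ncoeff (A.Y u) n

/-- The weight space `V₍ₙ₎ = {v | L(0) v = n v}`. -/
def weightSpace (n : ℤ) : Submodule ℂ V := (A.mode A.conformal 1).eigenspace (n : ℂ)

/-- CFT type: `V₍ₙ₎ = 0` for `n < 0` and `V₍₀₎ = ℂ𝟏`. -/
def IsCFTType : Prop :=
  (∀ n : ℤ, n < 0 → A.weightSpace n = ⊥) ∧ A.weightSpace 0 = Submodule.span ℂ {A.vacuum}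

/-- `C₂(V)`, spanned by `Resₓ x⁻² Y(u,x)v = u₋₂ v`. -/
def C2 : Submodule ℂ V := Submodule.span ℂ {x | ∃ u v : V, x = A.mode u (-2) v}

/-- `C₂(V)` has finite codimension in `V`. -/
def IsC2Cofinite : Prop := FiniteDimensional ℂ (V ⧸ A.C2)

/-- An automorphism of a vertex operator algebra. -/
structure Automorphism where
  /-- the underlying linear automorphism -/
  toEquiv : V ≃ₗ[ℂ] V
  map_vacuum : toEquiv A.vacuum = A.vacuum
  map_conformal : toEquiv A.conformal = A.conformal
  map_mode : ∀ (u v : V) (n : ℤ),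
    toEquiv (A.mode u n v) = A.mode (toEquiv u) n (toEquiv v)

namespace Automorphism

variable {A} (g : A.Automorphism)

/-- The automorphism as an endomorphism of `V`. -/
def toEnd : Module.End ℂ V := g.toEquiv.toLinearMap

/-- `V` is the sum of the generalized eigenspaces of `g`. -/
theorem iSup_maxGenEigenspace : ⨆ μ, g.toEnd.maxGenEigenspace μ = ⊤ := by
  rw [eq_top_iff, ← A.grading]
  refine iSup_le fun n => ?_
  have := A.weight_finite n
  refine LocFinLog.le_iSup_maxGenEigenspace _ _ fun v hv => ?_
  have hv' : A.mode A.conformal 1 v = (n : ℂ) • v := Module.End.mem_eigenspace_iff.1 hv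
  refine Module.End.mem_eigenspace_iff.2 ?_
  have h := g.map_mode A.conformal v 1
  rw [g.map_conformal, hv', map_smul] at h
  exact h.symm

/-- The operator `𝓢` on `V`. -/
def S : Module.End ℂ V := LocFinLog.semisimplePart g.iSup_maxGenEigenspace

/-- The operator `𝓝` on `V`. -/
def N : Module.End ℂ V := LocFinLog.nilpotentPart g.iSup_maxGenEigenspace

/-- The operator `𝓛 = 𝓢 + 𝓝`, for which `g = exp (2πi𝓛)`. -/
def L : Module.End ℂ V := g.S + g.N

/-- `V^[α] = {v | 𝓢 v = α v}`. -/
def twistSpace (α : ℂ) : Submodule ℂ V := g.S.eigenspace α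

end Automorphism

/-- The coefficient of
`x₀⁻ˡ⁻¹ · x₁⁻ᵐ⁻¹ (log x₁)ᵃ · x₂⁻ⁿ⁻¹ (log x₂)ᵇ` in
`x₀⁻¹δ((x₁-x₂)/x₀)Y_W(u,x₁)Y_W(v,x₂)w - x₀⁻¹δ((-x₂+x₁)/x₀)Y_W(v,x₂)Y_W(u,x₁)w`, where
`Y_W(u,x) = ∑ₖ ∑ₙ u(n,k) x⁻ⁿ⁻¹ (log x)ᵏ` and `act u n k` is `u(n,k)`. -/
def jacobiLeft {W : Type*} [AddCommGroup W] [Module ℂ W]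
    (act : V →ₗ[ℂ] (ℂ → ℕ → Module.End ℂ W)) (u v : V) (w : W)
    (l : ℤ) (m n : ℂ) (a b : ℕ) : W :=
  (∑ᶠ i : ℕ, ((-1 : ℂ) ^ i * (Ring.choose l i : ℤ)) •
      act u (l + m - i) a (act v (n + i) b w)) -
    (∑ᶠ i : ℕ, ((-1 : ℂ) ^ (l - i : ℤ) * (Ring.choose l i : ℤ)) •
      act v (l + n - i) b (act u (m + i) a w))

/-- For `u ∈ V^[α]` and `m = α + r`, the coefficient of
`x₀⁻ˡ⁻¹ · x₁⁻ᵐ⁻¹ (log x₁)ᵃ · x₂⁻ⁿ⁻¹ (log x₂)ᵇ` in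
`x₁⁻¹δ((x₂+x₀)/x₁) Y_W(Y(((x₂+x₀)/x₁)^𝓛 u, x₀)v, x₂)w`. Here
`x₁⁻¹δ((x₂+x₀)/x₁)((x₂+x₀)/x₁)^𝓛 u = ∑ᵣ x₁⁻¹ ((x₂+x₀)/x₁)^(r+𝓛) u` is expanded in nonnegative
powers of `x₀`:
`((x₂+x₀)/x₁)^(r+𝓛) u = ∑ⱼ x₀ʲ x₂^(r+α-j) x₁^(-r-α) e^(𝓝 log x₂) e^(-𝓝 log x₁) (r+𝓛 choose j) u`. -/
def jacobiRight {g : A.Automorphism} {W : Type*} [AddCommGroup W] [Module ℂ W]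
    (act : V →ₗ[ℂ] (ℂ → ℕ → Module.End ℂ W)) (α : ℂ) (u v : V) (w : W)
    (l r : ℤ) (n : ℂ) (a b : ℕ) : W :=
  ∑ᶠ j : ℕ, ∑ p ∈ Finset.HasAntidiagonal.antidiagonal b,
    act (A.mode
        (((Nat.factorial p.1 : ℂ)⁻¹ • g.N ^ p.1) (((Nat.factorial a : ℂ)⁻¹ • (-g.N) ^ a)
          (opChoose ((r : ℂ) • 1 + g.L) j u))) (l + j) v)
      (α + r + n - j) p.2 w

/-- A weak `g`-twisted `V`-module: a linear map
`u ↦ Y_W(u,x) = ∑ₖ ∑ₙ u(n,k) x⁻ⁿ⁻¹ (log x)ᵏ` from `V` to `(End W){x}[log x]`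
(`n` runs over `ℂ`), with `act u n k = u(n,k)`. -/
structure WeakTwistedModule (g : A.Automorphism) (W : Type*) [AddCommGroup W] [Module ℂ W] where
  /-- `act u n k` is the coefficient `u(n,k)` -/
  act : V →ₗ[ℂ] (ℂ → ℕ → Module.End ℂ W)
  /-- `Y_W(u,x)` is a polynomial in `log x` -/
  log_bounded : ∀ u : V, ∃ K : ℕ, ∀ (n : ℂ) (k : ℕ), K < k → act u n k = 0
  /-- the lower truncation property -/
  truncation : ∀ (u : V) (w : W) (n : ℂ) (k : ℕ), ∃ l₀ : ℤ, ∀ l : ℤ, l₀ ≤ l →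
    act u (n + l) k w = 0
  /-- the identity property `Y_W(𝟏,x) = id` -/
  identity : ∀ (n : ℂ) (k : ℕ),
    act A.vacuum n k = open Classical in if n = -1 ∧ k = 0 then 1 else 0
  /-- The Jacobi identity, for `u ∈ V^[α]` (these subspaces span `V`) and the coefficients with
  exponents of `x₁` in `-α + ℤ` -/
  jacobi : ∀ (α : ℂ) (u : V), u ∈ g.twistSpace α → ∀ (v : V) (w : W) (l r : ℤ) (n : ℂ) (a b : ℕ),
    jacobiLeft act u v w l (α + r) n a b = A.jacobiRight (g := g) act α u v w l r n a b
  /-- The Jacobi identity, for `u ∈ V^[α]` and the coefficients with exponents of `x₁` not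
  in `-α + ℤ`, which vanish on the right-hand side -/
  jacobi_off : ∀ (α : ℂ) (u : V), u ∈ g.twistSpace α → ∀ (v : V) (w : W) (l : ℤ) (m n : ℂ)
    (a b : ℕ), (∀ r : ℤ, m ≠ α + r) → jacobiLeft act u v w l m n a b = 0
  /-- The equivariance property `e^(2πi x d/dx) Y_W(gu,x) = Y_W(u,x)`, as the equality of the
  coefficients of `x⁻ⁿ⁻¹ (log x)ʲ`; the operator sends `x⁻ⁿ⁻¹ (log x)ᵏ` to
  `e^(2πi(-n-1)) x⁻ⁿ⁻¹ (log x + 2πi)ᵏ` -/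
  equivariance : ∀ (u : V) (n : ℂ) (j : ℕ),
    ∑ᶠ k : ℕ, (Complex.exp (2 * Real.pi * Complex.I * (-n - 1)) *
      ((k.choose j : ℂ) * (2 * Real.pi * Complex.I) ^ (k - j))) • act (g.toEquiv u) n k =
    act u n j

namespace WeakTwistedModule

variable {A} {g : A.Automorphism} {W : Type*} [AddCommGroup W] [Module ℂ W]
  (T : A.WeakTwistedModule g W)

/-- The algebra generated by the coefficients of all `Y_W(u,x)`. -/
def modeAlgebra : Subalgebra ℂ (Module.End ℂ W) :=
  Algebra.adjoin ℂ {f | ∃ (u : V) (n : ℂ) (k : ℕ), f = T.act u n k}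

/-- `W` is generated by the vector `w`. -/
def IsGeneratedBy (w : W) : Prop := ∀ x : W, ∃ e ∈ T.modeAlgebra, e w = x

end WeakTwistedModule

end VertexOperatorAlgebra

end

noncomputable section

/-! ### Independent families of submodules -/

/-! Let `F p` be the span of the monomials in modes of the generators in `B`, applied to `w`, of
total weight at most `p`. The argument takes place modulo lower terms of this filtration. The Jacobi
identity with `l = -2, 0, -1` gives three facts: modes of elements of `C₂(V)` have lower degree than
their weight predicts; modes commute up to lower degree; and modes of `u₋₁v` are convolutions of
modes of `u` and `v` up to lower degree (`act_C2Weight_mem`, `commutator_mem`,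
`act_mode_neg_one_sub_mem`). The first makes every mode of weight `q` shift `F` by at most `q`
(`shifts_monomialFiltration`), whence `F` exhausts `W`.

CFT type forces each generator in `B` to have weight at least 1, so an iterated product of `k ≥ M`
generators has weight at least `M` and lies in `C₂(V)`. Its modes therefore have lower degree, and
so do the sums of all products of `k` modes with prescribed total index (`sum_modeProd_mem`). With
`k = M + 1` this relation replaces a block of `M + 1` equal indices by blocks with the same sum and
a larger sum of squares. Indices at most `L` may be dropped modulo lower degree, so the indices are
bounded below and the replacement terminates (`modeProd_mem_orderedSpan`). Sorting and induction on
the degree finish the proof. The bound `M` is obtained for every index, not only for those up to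
`N`. -/

/-- A subfamily of an independent family contains every member of the family that lies in the
sum of the subfamily. -/
theorem iSupIndep.le_of_le_iSup {R M ι : Type*} [Ring R] [AddCommGroup M] [Module R M]
    {p q : ι → Submodule R M} (hp : iSupIndep p) (hq : ∀ i, q i ≤ p i) (i : ι)
    (h : p i ≤ ⨆ j, q j) : p i ≤ q i := by
  intro x hx
  have hle : ⨆ j, q j ≤ q i ⊔ ⨆ (j) (_ : j ≠ i), p j := by
    refine iSup_le fun j => ?_
    by_cases hj : j = i
    · subst hj
      exact le_sup_left
    · exact (hq j).trans (le_sup_of_le_right (le_iSup₂_of_le j hj le_rfl))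
  obtain ⟨y, hy, z, hz, rfl⟩ := Submodule.mem_sup.1 (hle (h hx))
  have hz' : z ∈ p i := by simpa using (p i).sub_mem hx (hq i hy)
  have : z = 0 := Submodule.disjoint_def.1 (hp i) z hz' hz
  simpa [this] using hy

theorem Submodule.finsum_mem_of_forall {R M ι : Type*} [Ring R] [AddCommGroup M] [Module R M]
    (p : Submodule R M) {f : ι → M} (h : ∀ i, f i ∈ p) : ∑ᶠ i, f i ∈ p :=
  finsum_induction (· ∈ p) p.zero_mem (fun _ _ => p.add_mem) h

/-- The terms from `n` on of a finitely supported sum. -/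
theorem Submodule.finsum_sub_sum_range_mem {R M : Type*} [Ring R] [AddCommGroup M] [Module R M]
    (p : Submodule R M) {f : ℕ → M} (n K : ℕ) (hK : ∀ i, K ≤ i → f i = 0)
    (h : ∀ i, n ≤ i → f i ∈ p) : ∑ᶠ i, f i - ∑ i ∈ Finset.range n, f i ∈ p := by
  have hs : Function.support f ⊆ Finset.range (n + K) := by
    intro i hi
    by_contra hlt
    simp only [Finset.coe_range, Set.mem_Iio, not_lt] at hlt
    exact hi (hK i (by omega))
  rw [finsum_eq_sum_of_support_subset f hs, Finset.sum_range_add, add_sub_cancel_left]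
  exact p.sum_mem fun i _ => h _ (by omega)

/-! ### Invariant subspaces under the logarithm of an operator -/

namespace LocFinLog

variable {V : Type*} [AddCommGroup V] [Module ℂ V]

/-- An invariant finite-dimensional subspace is the sum of its intersections with the generalized
eigenspaces. -/
theorem le_iSup_inf_maxGenEigenspace (f : Module.End ℂ V) (p : Submodule ℂ V)
    [FiniteDimensional ℂ p] (hp : ∀ x ∈ p, f x ∈ p) :
    p ≤ ⨆ μ, p ⊓ f.maxGenEigenspace μ := by
  have h := Module.End.iSup_maxGenEigenspace_eq_top (LinearMap.restrict f hp : Module.End ℂ p)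
  have h2 : p = (⨆ μ, Module.End.maxGenEigenspace (LinearMap.restrict f hp) μ).map p.subtype := by
    rw [h, Submodule.map_top, Submodule.range_subtype]
  conv_lhs => rw [h2, Submodule.map_iSup]
  refine iSup_mono fun μ => ?_
  rintro _ ⟨x, hx, rfl⟩
  refine ⟨x.2, ?_⟩
  rw [SetLike.mem_coe, Module.End.maxGenEigenspace, Module.End.genEigenspace_restrict] at hx
  exact hx

theorem maxGenEigenspace_le_eigenspace_semisimplePart {f : Module.End ℂ V}
    (hf : ⨆ μ, f.maxGenEigenspace μ = ⊤) (μ : ℂ) :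
    f.maxGenEigenspace μ ≤ (semisimplePart hf).eigenspace (stripLog μ) := by
  intro v hv
  rw [Module.End.mem_eigenspace_iff]
  exact glue_apply hf (fun μ => stripLog μ • (f.maxGenEigenspace μ).subtype) μ ⟨v, hv⟩

/-- Every term of the logarithm series is a polynomial in `f` applied to `v`. -/
theorem nilpotentPart_mem {f : Module.End ℂ V} (hf : ⨆ μ, f.maxGenEigenspace μ = ⊤)
    {p : Submodule ℂ V} (hp : ∀ x ∈ p, f x ∈ p) {μ : ℂ} {v : V} (hv : v ∈ f.maxGenEigenspace μ)
    (hvp : v ∈ p) : nilpotentPart hf v ∈ p := by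
  have h := glue_apply hf (unipotentLog f) μ ⟨v, hv⟩
  have h' : nilpotentPart hf v = unipotentLog f μ ⟨v, hv⟩ := h
  rw [h']
  refine p.smul_mem _ (p.finsum_mem_of_forall fun k => p.smul_mem _ ?_)
  generalize k + 1 = j
  induction j with
  | zero => simpa using hvp
  | succ j ih =>
    rw [pow_succ', Module.End.mul_apply]
    simp only [LinearMap.smul_apply, LinearMap.sub_apply, Module.End.one_apply]
    exact p.smul_mem _ (p.sub_mem (hp _ ih) (p.smul_mem _ ih))

end LocFinLog

@[simp]
theorem opChoose_zero {V : Type*} [AddCommGroup V] [Module ℂ V] (T : Module.End ℂ V) :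
    opChoose T 0 = 1 := by
  simp [opChoose]

theorem opChoose_mem {V : Type*} [AddCommGroup V] [Module ℂ V] {T : Module.End ℂ V}
    {p : Submodule ℂ V} (hp : ∀ x ∈ p, T x ∈ p) (j : ℕ) {v : V} (hv : v ∈ p) :
    opChoose T j v ∈ p := by
  refine p.smul_mem _ ?_
  generalize descPochhammer ℂ j = P
  induction P using Polynomial.induction_on' with
  | add P Q hP hQ => simpa using p.add_mem hP hQ
  | monomial n c =>
    rw [Polynomial.aeval_monomial, Module.End.mul_apply, Module.algebraMap_end_apply]
    refine p.smul_mem _ ?_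
    induction n with
    | zero => simpa using hv
    | succ n ih =>
      rw [pow_succ', Module.End.mul_apply]
      exact hp _ ih

/-! ### Weight spaces and their compatibility with `𝓢` and `𝓝` -/

namespace VertexOperatorAlgebra

variable {V : Type*} [AddCommGroup V] [Module ℂ V] (A : VertexOperatorAlgebra V)

theorem iSupIndep_weightSpace : iSupIndep A.weightSpace :=
  (Module.End.eigenspaces_iSupIndep (A.mode A.conformal 1)).comp Int.cast_injective

theorem iSup_weightSpace : ⨆ n, A.weightSpace n = ⊤ := A.grading

theorem mem_weightSpace {n : ℤ} {v : V} :
    v ∈ A.weightSpace n ↔ A.mode A.conformal 1 v = (n : ℂ) • v :=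
  Module.End.mem_eigenspace_iff

/-- `L(0) uₙ v = uₙ L(0) v + (L(0)u)ₙ v - (n + 1) uₙ v`. -/
theorem mode_mem_weightSpace {p q : ℤ} {u v : V} (hu : u ∈ A.weightSpace p)
    (hv : v ∈ A.weightSpace q) (n : ℤ) : A.mode u n v ∈ A.weightSpace (p + q - n - 1) := by
  rw [mem_weightSpace] at *
  -- This is the commutator of `L(0)` with `uₙ`: `l = 0` leaves one term in each sum on the left,
  -- and `m = 1` leaves the terms of `L(-1)u` and `L(0)u` on the right.
  have h := A.jacobi A.conformal u v 0 1 n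
  rw [finsum_eq_single _ 0 (fun i hi => by simp [Ring.choose_zero_pos ℤ (Nat.pos_of_ne_zero hi)]),
    finsum_eq_single _ 0 (fun i hi => by simp [Ring.choose_zero_pos ℤ (Nat.pos_of_ne_zero hi)]),
    finsum_eq_sum_of_support_subset (s := Finset.range 2) _ (fun i hi => by
      by_contra hlt
      simp only [Finset.coe_range, Set.mem_Iio, not_lt] at hlt
      apply hi
      have : Ring.choose (1 : ℤ) i = 0 := by
        have := Ring.choose_natCast (R := ℤ) 1 i
        rw [Nat.choose_eq_zero_of_lt (by omega)] at this
        simpa using this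
      simp [this])] at h
  simp only [Finset.sum_range_succ, Finset.sum_range_zero] at h
  have e1 : VertexOperator.ncoeff (A.Y A.conformal) 1 v = (q : ℂ) • v := hv
  have e2 : VertexOperator.ncoeff (A.Y A.conformal) 1 u = (p : ℂ) • u := hu
  have e3 := A.derivative u (1 + n)
  simp only [Ring.choose_zero_right, Ring.choose_one_right, Nat.cast_zero, Nat.cast_one, pow_zero,
    zero_add, add_zero, sub_zero, Int.cast_one, one_smul, mul_one, e1, e2, map_smul, e3,
    zpow_zero, LinearMap.smul_apply, Pi.smul_apply] at h
  simp only [add_sub_cancel_left] at h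
  change A.mode A.conformal 1 (A.mode u n v) - _ • A.mode u n v =
    _ • A.mode u n v + _ • A.mode u n v at h
  rw [sub_eq_iff_eq_add] at h
  rw [h, ← add_smul, ← add_smul]
  congr 1
  push_cast
  ring

theorem vacuum_mem_weightSpace : A.vacuum ∈ A.weightSpace 0 := by
  rw [mem_weightSpace]
  rw [Int.cast_zero, zero_smul]
  exact A.creation_reg A.conformal 1 (by norm_num)

namespace Automorphism

variable {A} (g : A.Automorphism)

theorem toEnd_mem_weightSpace {n : ℤ} {v : V} (hv : v ∈ A.weightSpace n) :
    g.toEnd v ∈ A.weightSpace n := by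
  rw [mem_weightSpace] at *
  have h := g.map_mode A.conformal v 1
  rw [g.map_conformal, hv, map_smul] at h
  exact h.symm

theorem weightSpace_le (n : ℤ) :
    A.weightSpace n ≤ ⨆ μ, A.weightSpace n ⊓ g.toEnd.maxGenEigenspace μ :=
  have : FiniteDimensional ℂ (A.weightSpace n) := A.weight_finite n
  LocFinLog.le_iSup_inf_maxGenEigenspace _ _ fun _ => g.toEnd_mem_weightSpace

theorem maxGenEigenspace_le_twistSpace (μ : ℂ) :
    g.toEnd.maxGenEigenspace μ ≤ g.twistSpace (LocFinLog.stripLog μ) :=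
  LocFinLog.maxGenEigenspace_le_eigenspace_semisimplePart _ μ

/-- The twisted Jacobi identity is available only for `u` in some `V^[α]`; this splitting reduces to
that case without losing the weight. -/
theorem weightSpace_le_iSup_inf_twistSpace (n : ℤ) :
    A.weightSpace n ≤ ⨆ α, A.weightSpace n ⊓ g.twistSpace α :=
  (g.weightSpace_le n).trans <| iSup_le fun μ => le_iSup_of_le (LocFinLog.stripLog μ) <|
    inf_le_inf_left _ (g.maxGenEigenspace_le_twistSpace μ)

theorem iSup_inf_twistSpace : ⨆ n, ⨆ α, A.weightSpace n ⊓ g.twistSpace α = ⊤ := by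
  rw [eq_top_iff, ← A.iSup_weightSpace]
  exact iSup_mono g.weightSpace_le_iSup_inf_twistSpace

theorem S_mem_weightSpace {n : ℤ} {v : V} (hv : v ∈ A.weightSpace n) :
    g.S v ∈ A.weightSpace n := by
  have h : A.weightSpace n ≤ (A.weightSpace n).comap g.S :=
    (g.weightSpace_le_iSup_inf_twistSpace n).trans <| iSup_le fun α x hx => by
      have : g.S x = α • x := Module.End.mem_eigenspace_iff.1 hx.2
      rw [Submodule.mem_comap, this]
      exact Submodule.smul_mem _ _ hx.1
  exact h hv

theorem N_mem_weightSpace {n : ℤ} {v : V} (hv : v ∈ A.weightSpace n) :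
    g.N v ∈ A.weightSpace n := by
  have h : A.weightSpace n ≤ (A.weightSpace n).comap g.N :=
    (g.weightSpace_le n).trans <| iSup_le fun μ x hx =>
      LocFinLog.nilpotentPart_mem _ (fun _ => g.toEnd_mem_weightSpace) hx.2 hx.1
  exact h hv

theorem opChoose_mem_weightSpace {n : ℤ} {v : V} (hv : v ∈ A.weightSpace n) (c : ℂ) (j : ℕ) :
    opChoose (c • 1 + g.L) j v ∈ A.weightSpace n := by
  refine opChoose_mem (fun x hx => ?_) j hv
  simp only [LinearMap.add_apply, LinearMap.smul_apply, Module.End.one_apply, L]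
  exact Submodule.add_mem _ (Submodule.smul_mem _ _ hx)
    (Submodule.add_mem _ (g.S_mem_weightSpace hx) (g.N_mem_weightSpace hx))

end Automorphism

/-! ### The weight grading of `C₂(V)` -/

/-- The part of `C₂(V)` of weight `n`, spanned by `a₋₂c` with `a` and `c` homogeneous. -/
def C2Weight (g : A.Automorphism) (n : ℤ) : Submodule ℂ V :=
  Submodule.span ℂ {x | ∃ (p q : ℤ) (α : ℂ) (a c : V), p + q + 1 = n ∧ a ∈ A.weightSpace p ∧
    a ∈ g.twistSpace α ∧ c ∈ A.weightSpace q ∧ x = A.mode a (-2) c}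

variable {A}

theorem C2Weight_le (g : A.Automorphism) (n : ℤ) : A.C2Weight g n ≤ A.weightSpace n := by
  refine Submodule.span_le.2 ?_
  rintro _ ⟨p, q, α, a, c, h, ha, -, hc, rfl⟩
  have := A.mode_mem_weightSpace ha hc (-2)
  rwa [show p + q - -2 - 1 = n by omega] at this

/-- By bilinearity of `u₋₂v`: `u` is split by weight and `𝓢`-eigenvalue, `v` by weight alone. -/
theorem C2_le_iSup_C2Weight (g : A.Automorphism) : A.C2 ≤ ⨆ n, A.C2Weight g n := by
  refine Submodule.span_le.2 ?_
  rintro _ ⟨u, v, rfl⟩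
  have hu : u ∈ ⨆ n, ⨆ α, A.weightSpace n ⊓ g.twistSpace α := by
    rw [g.iSup_inf_twistSpace]; trivial
  have hv : v ∈ ⨆ n, A.weightSpace n := by
    rw [A.iSup_weightSpace]; trivial
  have key : ∀ u : V, A.mode u (-2) = (LinearMap.proj (-2) ∘ₗ VertexOperator.ncoeff ∘ₗ A.Y :
    V →ₗ[ℂ] Module.End ℂ V) u := fun u => rfl
  have h1 : (⨆ n, ⨆ α, A.weightSpace n ⊓ g.twistSpace α) ≤ (⨆ n, A.C2Weight g n).comap
      (((LinearMap.proj (-2) ∘ₗ VertexOperator.ncoeff ∘ₗ A.Y :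
        V →ₗ[ℂ] Module.End ℂ V)).flip v) := by
    refine iSup_le fun p => iSup_le fun α a ha => ?_
    have h2 : (⨆ n, A.weightSpace n) ≤ (⨆ n, A.C2Weight g n).comap (A.mode a (-2)) := by
      refine iSup_le fun q c hc => ?_
      exact Submodule.mem_iSup_of_mem (p + q + 1)
        (Submodule.subset_span ⟨p, q, α, a, c, rfl, ha.1, ha.2, hc, rfl⟩)
    exact h2 hv
  exact h1 hu

/-- A weight space contained in `C₂(V)` is spanned by homogeneous products `a₋₂c`. -/
theorem weightSpace_le_C2Weight (g : A.Automorphism) {n : ℤ} (h : A.weightSpace n ≤ A.C2) :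
    A.weightSpace n ≤ A.C2Weight g n :=
  A.iSupIndep_weightSpace.le_of_le_iSup (C2Weight_le g) n (h.trans (C2_le_iSup_C2Weight g))

/-- Homogeneous representatives of a basis of `V / C₂(V)` span each weight space modulo
`C₂(V)`. -/
theorem weightSpace_le_span_sup_C2Weight (g : A.Automorphism) {I : Type*}
    (e : Module.Basis I ℂ (V ⧸ A.C2)) {b : I → V} {wt : I → ℤ} (hb : ∀ i, A.C2.mkQ (b i) = e i)
    (hwt : ∀ i, b i ∈ A.weightSpace (wt i)) (n : ℤ) :
    A.weightSpace n ≤ Submodule.span ℂ {x | ∃ i, wt i = n ∧ x = b i} ⊔ A.C2Weight g n := by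
  refine A.iSupIndep_weightSpace.le_of_le_iSup
    (q := fun n => Submodule.span ℂ {x | ∃ i, wt i = n ∧ x = b i} ⊔ A.C2Weight g n)
    (fun n => sup_le (Submodule.span_le.2 ?_) (C2Weight_le g n)) n ?_
  · rintro _ ⟨i, rfl, rfl⟩
    exact hwt i
  have hC : A.C2 ≤ ⨆ n, Submodule.span ℂ {x | ∃ i, wt i = n ∧ x = b i} ⊔ A.C2Weight g n :=
    (C2_le_iSup_C2Weight g).trans (iSup_mono fun n => le_sup_right)
  intro x _
  have hx : A.C2.mkQ x ∈ Submodule.span ℂ (Set.range e) := by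
    rw [e.span_eq]; trivial
  have : Set.range e = A.C2.mkQ '' Set.range b := by
    rw [← Set.range_comp]
    exact congrArg Set.range (funext fun i => (hb i).symm)
  rw [this, ← Submodule.map_span] at hx
  obtain ⟨y, hy, hxy⟩ := hx
  have h1 : x - y ∈ A.C2 := (Submodule.Quotient.eq _).1 hxy.symm
  have h2 : Submodule.span ℂ (Set.range b) ≤
      ⨆ n, Submodule.span ℂ {x | ∃ i, wt i = n ∧ x = b i} ⊔ A.C2Weight g n := by
    refine Submodule.span_le.2 ?_
    rintro _ ⟨i, rfl⟩
    exact Submodule.mem_iSup_of_mem (wt i)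
      (Submodule.mem_sup_left (Submodule.subset_span ⟨i, rfl, rfl⟩))
  simpa using Submodule.add_mem _ (hC h1) (h2 hy)

namespace WeakTwistedModule

variable {V : Type*} [AddCommGroup V] [Module ℂ V] {A : VertexOperatorAlgebra V}
  {g : A.Automorphism} {W : Type*} [AddCommGroup W] [Module ℂ W] (T : A.WeakTwistedModule g W)

/-! ### The coefficients of powers of the logarithm -/

theorem act_vacuum_of_ne {n : ℂ} (hn : n ≠ -1) (k : ℕ) : T.act A.vacuum n k = 0 := by
  rw [T.identity, if_neg fun h => hn h.1]

theorem act_vacuum_neg_one : T.act A.vacuum (-1) 0 = 1 := by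
  rw [T.identity, if_pos ⟨rfl, rfl⟩]

/-- Only the mode of index `-1` of the vacuum is nonzero. The first sum involves its indices `0 + i`
and vanishes; the second involves `-1 - i` and keeps `i = 0`, where the sign `(-1)⁻¹` cancels the
minus sign. -/
theorem jacobiLeft_vacuum (u : V) (w : W) (m : ℂ) (a : ℕ) :
    jacobiLeft T.act u A.vacuum w (-1) m 0 a 0 = T.act u m a w := by
  have h1 : ∀ i : ℕ, T.act A.vacuum ((0 : ℂ) + i) 0 = 0 := fun i =>
    T.act_vacuum_of_ne (fun h => by
      have := congrArg Complex.re h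
      simp only [zero_add, Complex.natCast_re, Complex.neg_re, Complex.one_re] at this
      have h0 : (0 : ℝ) ≤ i := i.cast_nonneg
      linarith) 0
  have h2 : ∀ i : ℕ, i ≠ 0 → T.act A.vacuum (((-1 : ℤ) : ℂ) + 0 - i) 0 = 0 := fun i hi =>
    T.act_vacuum_of_ne (fun h => hi (by
      have : (i : ℂ) = 0 := by
        push_cast at h
        linear_combination -h
      exact_mod_cast this)) 0
  rw [jacobiLeft, finsum_eq_single _ 0 (fun i _ => by rw [h1]; simp),
    finsum_eq_single _ 0 (fun i hi => by rw [h2 i hi]; simp), h1]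
  simp [T.act_vacuum_neg_one]

/-- The coefficients of the powers of the logarithm are obtained from the nilpotent part. -/
theorem act_log {α : ℂ} {u : V} (hu : u ∈ g.twistSpace α) (r : ℤ) (a : ℕ) :
    T.act u (α + r) a = T.act ((Nat.factorial a : ℂ)⁻¹ • ((-g.N) ^ a) u) (α + r) 0 := by
  ext w
  -- On the right, `x₍₋₁₊ⱼ₎𝟏 = 0` for `j > 0`, and the term `j = 0` is the factor `(-𝓝)ᵃ/a!` applied
  -- to `u`.
  have h := T.jacobi α u hu A.vacuum w (-1) r 0 a 0
  rw [T.jacobiLeft_vacuum, jacobiRight, finsum_eq_single _ 0] at h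
  · rw [h]
    simp [mode, A.creation]
  · intro i hi
    have : ∀ x, A.mode x (-1 + i) A.vacuum = 0 := fun x =>
      A.creation_reg x _ (by omega)
    simp [this]

theorem act_eq_zero {α : ℂ} {u : V} (hu : u ∈ g.twistSpace α) {m : ℂ} (hm : ∀ r : ℤ, m ≠ α + r)
    (a : ℕ) : T.act u m a = 0 := by
  ext w
  rw [← T.jacobiLeft_vacuum, T.jacobi_off α u hu _ _ _ _ _ _ _ hm, LinearMap.zero_apply]

/-! ### Filtrations by weight -/

/-- The modes of elements of weight `q` shift the filtration `F` by at most `q`. -/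
def Shifts (F : ℤ → Submodule ℂ W) (q : ℤ) : Prop :=
  ∀ u ∈ A.weightSpace q, ∀ (m : ℂ) (p : ℤ), ∀ x ∈ F p, T.act u m 0 x ∈ F (p + q)

variable {T} {F : ℤ → Submodule ℂ W}

theorem shifts_of_neg (hCFT : A.IsCFTType) {q : ℤ} (hq : q < 0) : T.Shifts F q := by
  intro u hu m p x _
  rw [hCFT.1 q hq, Submodule.mem_bot] at hu
  simp [hu]

/-- The Jacobi identity modulo elements of lower filtration degree. -/
theorem jacobiLeft_sub_mem (hCFT : A.IsCFTType) (hF : Monotone F) {α : ℂ} {r r' : ℤ} {u v : V}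
    (hu : u ∈ A.weightSpace r) (huα : u ∈ g.twistSpace α) (hv : v ∈ A.weightSpace r') (l : ℤ)
    (hA : ∀ q ≤ r + r' - l - 2, T.Shifts F q) (k : ℤ) (n : ℂ) {p : ℤ} {x : W} (hx : x ∈ F p) :
    jacobiLeft T.act u v x l (α + k) n 0 0 - T.act (A.mode u l v) (α + k + n) 0 x ∈
      F (p + r + r' - l - 2) := by
  rw [T.jacobi α u huα v x l k n 0 0, jacobiRight]
  simp only [Finset.Nat.antidiagonal_zero, Finset.sum_singleton, Nat.factorial_zero, Nat.cast_one,
    inv_one, pow_zero, one_smul, Module.End.one_apply]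
  have hw : ∀ j : ℕ, A.mode (opChoose ((k : ℂ) • 1 + g.L) j u) (l + j) v ∈
      A.weightSpace (r + r' - l - j - 1) := fun j => by
    have := A.mode_mem_weightSpace (g.opChoose_mem_weightSpace hu k j) hv (l + j)
    rwa [show r + r' - (l + j) - 1 = r + r' - l - j - 1 by omega] at this
  -- The `j`-th term comes from a vector of weight `r + r' - l - j - 1`. The term `j = 0` is the
  -- main one, later terms have lower weight, and from `j = r + r' - l` on the weight is negative
  -- and the term vanishes.
  have key := (F (p + r + r' - l - 2)).finsum_sub_sum_range_mem
    (f := fun j : ℕ => T.act (A.mode (opChoose ((k : ℂ) • 1 + g.L) j u) (l + j) v)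
      (α + k + n - j) 0 x) 1 (r + r' - l).toNat (fun j hj => by
        have h := hw j
        rw [hCFT.1 _ (by omega), Submodule.mem_bot] at h
        simp only [h, map_zero, Pi.zero_apply, LinearMap.zero_apply]) (fun j hj => by
        have h := hA _ (by omega) _ (hw j) (α + k + n - j) p x hx
        exact hF (by omega) h)
  simpa using key

/-- Elements of `C₂(V)` lower the filtration degree expected from their weight. -/
theorem act_C2Weight_mem (hCFT : A.IsCFTType) (hF : Monotone F) {q : ℤ}
    (hA : ∀ q' < q, T.Shifts F q') {u : V} (hu : u ∈ A.C2Weight g q) (m : ℂ) {p : ℤ} {x : W}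
    (hx : x ∈ F p) : T.act u m 0 x ∈ F (p + q - 1) := by
  induction hu using Submodule.span_induction with
  | zero => simp
  | add u v _ _ hu hv =>
    rw [map_add, Pi.add_apply, Pi.add_apply, LinearMap.add_apply]
    exact add_mem hu hv
  | smul c u _ hu =>
    rw [map_smul, Pi.smul_apply, Pi.smul_apply, LinearMap.smul_apply]
    exact Submodule.smul_mem _ c hu
  | mem u hu =>
    obtain ⟨r, r', α, a, c, rfl, ha, haα, hc, rfl⟩ := hu
    by_cases hr : r < 0
    · rw [hCFT.1 _ hr, Submodule.mem_bot] at ha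
      simp [ha, mode]
    by_cases hr' : r' < 0
    · rw [hCFT.1 _ hr', Submodule.mem_bot] at hc
      simp [hc]
    -- The weights of `a` and `c` add up to one less than that of `a₋₂c`, so both products on the
    -- left side have lower degree. Both weights are below `q`, so only shifts by smaller weights
    -- are used.
    have h1 := jacobiLeft_sub_mem hCFT hF ha haα hc (-2) (fun q hq => hA q (by omega)) 0 (m - α) hx
    have h2 : jacobiLeft T.act a c x (-2) (α + (0 : ℤ)) (m - α) 0 0 ∈ F (p + (r + r' + 1) - 1) := by
      refine sub_mem (Submodule.finsum_mem_of_forall _ fun i => Submodule.smul_mem _ _ ?_)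
        (Submodule.finsum_mem_of_forall _ fun i => Submodule.smul_mem _ _ ?_)
      · exact hF (by omega) (hA r (by omega) a ha _ _ _ (hA r' (by omega) c hc _ _ _ hx))
      · exact hF (by omega) (hA r' (by omega) c hc _ _ _ (hA r (by omega) a ha _ _ _ hx))
    have h3 := sub_mem h2 (hF (show p + r + r' - -2 - 2 ≤ p + (r + r' + 1) - 1 by omega) h1)
    rw [sub_sub_cancel] at h3
    rwa [show α + ((0 : ℤ) : ℂ) + (m - α) = m by push_cast; ring] at h3

/-- Commutators of modes lower the filtration degree. -/
theorem commutator_mem (hCFT : A.IsCFTType) (hF : Monotone F) (hA : ∀ q, T.Shifts F q) {α : ℂ}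
    {r r' : ℤ} {u v : V} (hu : u ∈ A.weightSpace r) (huα : u ∈ g.twistSpace α)
    (hv : v ∈ A.weightSpace r') (k : ℤ) (n : ℂ) {p : ℤ} {x : W} (hx : x ∈ F p) :
    T.act u (α + k) 0 (T.act v n 0 x) - T.act v n 0 (T.act u (α + k) 0 x) ∈
      F (p + r + r' - 1) := by
  have h1 := jacobiLeft_sub_mem hCFT hF hu huα hv 0 (fun q _ => hA q) k n hx
  have h2 := hA _ _ (A.mode_mem_weightSpace hu hv 0) (α + k + n) p x hx
  have h3 := add_mem (hF (show p + r + r' - 0 - 2 ≤ p + r + r' - 1 by omega) h1)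
    (hF (show p + (r + r' - 0 - 1) ≤ p + r + r' - 1 by omega) h2)
  rw [sub_add_cancel, jacobiLeft,
    finsum_eq_single _ 0 (fun i hi => by simp [Ring.choose_zero_pos ℤ (Nat.pos_of_ne_zero hi)]),
    finsum_eq_single _ 0 (fun i hi => by simp [Ring.choose_zero_pos ℤ (Nat.pos_of_ne_zero hi)])]
    at h3
  simpa using h3

variable (T F)

/-- For `i < 0` the mode `v(β - i)` lowers the filtration degree expected from the
weight `r` of `v`. -/
def LowersBelow (v : V) (r : ℤ) (β : ℂ) : Prop :=
  ∀ i : ℤ, i < 0 → ∀ p : ℤ, ∀ x ∈ F p, T.act v (β - i) 0 x ∈ F (p + r - 1)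

variable {T F}

/-- The coefficients of `(x₁ - x₂)⁻¹` are all 1, so the convolution below carries no coefficients.
-/
theorem neg_one_pow_mul_choose_neg_one (i : ℕ) : (-1 : ℤ) ^ i * Ring.choose (-1 : ℤ) i = 1 := by
  rw [Ring.choose_neg', Ring.multichoose_one, Int.negOnePow_def]
  simp [Units.smul_def, ← mul_pow]

/-- The modes of `u₋₁v` are convolutions of the modes of `u` and `v`, up to lower filtration
degree. -/
theorem act_mode_neg_one_sub_mem (hCFT : A.IsCFTType) (hF : Monotone F) (hA : ∀ q, T.Shifts F q)
    {α β : ℂ} {k r r' : ℤ} {u v : V} (hu : u ∈ A.weightSpace r) (huα : u ∈ g.twistSpace α)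
    (hv : v ∈ A.weightSpace r') (hul : T.LowersBelow F u r (α + k)) (hvl : T.LowersBelow F v r' β)
    (s : ℤ) {p : ℤ} {x : W} (hx : x ∈ F p) :
    T.act (A.mode u (-1) v) (α + k + β + 1 - s) 0 x -
      ∑ i ∈ Finset.range (s + 1).toNat, T.act u (α + k - i) 0 (T.act v (β - (s - i : ℤ)) 0 x) ∈
      F (p + r + r' - 1) := by
  -- The index `k + 1` compensates `l = -1`, so that the first product starts with `u(α + k)`.
  have h1 := jacobiLeft_sub_mem hCFT hF hu huα hv (-1) (fun q _ => hA q) (k + 1) (β - s) hx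
  obtain ⟨l₀, hl₀⟩ := T.truncation v x (β - s) 0
  -- For `i > s` the mode of `v` has index above `β` and lowers the degree; truncation makes the
  -- tail finite.
  have h2 := (F (p + r + r' - 1)).finsum_sub_sum_range_mem
    (f := fun i : ℕ => T.act u (α + k - i) 0 (T.act v (β - (s - i : ℤ)) 0 x)) (s + 1).toNat
    l₀.toNat (fun i hi => by
      have := hl₀ i (by omega)
      rw [show β - ((s - i : ℤ) : ℂ) = β - s + (i : ℤ) by push_cast; ring, this, map_zero])
    (fun i hi => by
      have := hvl (s - i) (by omega) p x hx
      exact hF (by omega) (hA r u hu (α + k - i) _ _ this))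
  -- In the second product every mode of `u` has index above `α + k`, so all its terms have lower
  -- degree.
  have h3 : ∑ᶠ i : ℕ, ((-1 : ℂ) ^ (-1 - i : ℤ) * (Ring.choose (-1) i : ℤ)) •
      T.act v ((-1 : ℤ) + (β - s) - i) 0 (T.act u (α + (k + 1 : ℤ) + i) 0 x) ∈
        F (p + r + r' - 1) := by
    refine Submodule.finsum_mem_of_forall _ fun i => Submodule.smul_mem _ _ ?_
    have := hul (-1 - i) (by omega) p x hx
    rw [show α + (k : ℂ) - ((-1 - i : ℤ) : ℂ) = α + (k + 1 : ℤ) + i by push_cast; ring] at this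
    exact hF (by omega) (hA r' v hv _ _ _ this)
  have h4 := sub_mem (sub_mem h2 h3) (hF (show p + r + r' - -1 - 2 ≤ p + r + r' - 1 by omega) h1)
  have e1 : ∀ i : ℕ, ((-1 : ℂ) ^ i * (Ring.choose (-1) i : ℤ)) •
      T.act u ((-1 : ℤ) + (α + (k + 1 : ℤ)) - i) 0 (T.act v (β - s + i) 0 x) =
      T.act u (α + k - i) 0 (T.act v (β - (s - i : ℤ)) 0 x) := fun i => by
    have : (-1 : ℂ) ^ i * (Ring.choose (-1) i : ℤ) = 1 := by
      exact_mod_cast congrArg (Int.cast : ℤ → ℂ) (neg_one_pow_mul_choose_neg_one i)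
    rw [this, one_smul, show ((-1 : ℤ) : ℂ) + (α + (k + 1 : ℤ)) - i = α + k - i by push_cast; ring,
      show β - s + (i : ℂ) = β - (s - i : ℤ) by push_cast; ring]
  rw [jacobiLeft] at h4
  simp only [e1] at h4
  rw [show α + ((k + 1 : ℤ) : ℂ) + (β - s) = α + k + β + 1 - s by push_cast; ring] at h4
  convert h4 using 1
  abel

end WeakTwistedModule

/-! ### The filtration of `W` by weights of monomials -/

/-- Homogeneous vectors `b i` spanning `V` modulo `C₂(V)` in each weight, those outside `B` being
multiples of the vacuum vector. -/
structure IsHomogeneousSystem {V : Type*} [AddCommGroup V] [Module ℂ V]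
    {A : VertexOperatorAlgebra V} (g : A.Automorphism) {I : Type*} (b : I → V) (wt : I → ℤ)
    (α : I → ℂ) (B : Set I) : Prop where
  weightSpace_le : ∀ n, A.weightSpace n ≤
    Submodule.span ℂ {x | ∃ i, wt i = n ∧ x = b i} ⊔ A.C2Weight g n
  mem_weightSpace : ∀ i, b i ∈ A.weightSpace (wt i)
  mem_twistSpace : ∀ i, b i ∈ g.twistSpace (α i)
  one_le : ∀ i ∈ B, 1 ≤ wt i
  mem_span_vacuum : ∀ i ∉ B, b i ∈ Submodule.span ℂ {A.vacuum}

namespace WeakTwistedModule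

variable {V : Type*} [AddCommGroup V] [Module ℂ V] {A : VertexOperatorAlgebra V}
  {g : A.Automorphism} {W : Type*} [AddCommGroup W] [Module ℂ W] (T : A.WeakTwistedModule g W)
  {I : Type*} (b : I → V) (wt : I → ℤ) (α : I → ℂ) (B : Set I) (w : W)

/-- The product of the modes `bᵢ(αᵢ - n)`, `(i, n)` in the list `s`. -/
def modeProd (s : List (I × ℤ)) : Module.End ℂ W :=
  (s.map fun p => T.act (b p.1) (α p.1 - p.2) 0).prod

/-- The total weight of the vectors occurring in a list of modes. -/
def wtSum (s : List (I × ℤ)) : ℤ := (s.map fun p => wt p.1).sum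

/-- The span of the monomials of total weight at most `p` applied to `w`. -/
def monomialFiltration (p : ℤ) : Submodule ℂ W :=
  Submodule.span ℂ {x | ∃ s : List (I × ℤ), (∀ q ∈ s, q.1 ∈ B) ∧ wtSum wt s ≤ p ∧
    x = T.modeProd b α s w}

@[simp]
theorem modeProd_nil : T.modeProd b α [] = 1 := rfl

@[simp]
theorem modeProd_cons (q : I × ℤ) (s : List (I × ℤ)) :
    T.modeProd b α (q :: s) = T.act (b q.1) (α q.1 - q.2) 0 * T.modeProd b α s := by
  simp [modeProd]

theorem modeProd_append (s t : List (I × ℤ)) :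
    T.modeProd b α (s ++ t) = T.modeProd b α s * T.modeProd b α t := by
  simp [modeProd]

@[simp]
theorem wtSum_nil : wtSum wt [] = 0 := rfl

@[simp]
theorem wtSum_cons (q : I × ℤ) (s : List (I × ℤ)) :
    wtSum wt (q :: s) = wt q.1 + wtSum wt s := by
  simp [wtSum]

theorem wtSum_append (s t : List (I × ℤ)) : wtSum wt (s ++ t) = wtSum wt s + wtSum wt t := by
  simp [wtSum]

theorem wtSum_perm {s t : List (I × ℤ)} (h : s.Perm t) : wtSum wt s = wtSum wt t :=
  (h.map _).sum_eq

variable {T b wt α B w}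

theorem modeProd_mem_monomialFiltration {s : List (I × ℤ)} (hs : ∀ q ∈ s, q.1 ∈ B) :
    T.modeProd b α s w ∈ T.monomialFiltration b wt α B w (wtSum wt s) :=
  Submodule.subset_span ⟨s, hs, le_rfl, rfl⟩

theorem monotone_monomialFiltration : Monotone (T.monomialFiltration b wt α B w) := by
  intro p q hpq
  refine Submodule.span_mono ?_
  rintro x ⟨s, hs, hle, rfl⟩
  exact ⟨s, hs, hle.trans hpq, rfl⟩

theorem act_mem_monomialFiltration (hS : IsHomogeneousSystem g b wt α B) {i : I} (hi : i ∈ B)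
    (m : ℂ) {p : ℤ} {x : W} (hx : x ∈ T.monomialFiltration b wt α B w p) :
    T.act (b i) m 0 x ∈ T.monomialFiltration b wt α B w (p + wt i) := by
  by_cases hm : ∃ r : ℤ, m = α i + r
  · obtain ⟨r, rfl⟩ := hm
    induction hx using Submodule.span_induction with
    | zero => simp
    | add x y _ _ hx hy => rw [map_add]; exact add_mem hx hy
    | smul c x _ hx => rw [map_smul]; exact Submodule.smul_mem _ c hx
    | mem x hx =>
      obtain ⟨s, hs, hle, rfl⟩ := hx
      refine Submodule.subset_span ⟨(i, -r) :: s, ?_, ?_, ?_⟩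
      · simpa [hi] using hs
      · rw [wtSum_cons]
        linarith
      · simp
  · push Not at hm
    rw [T.act_eq_zero (hS.mem_twistSpace i) hm]
    simp

/-- Induction on `q`: modulo `C₂(V)` a vector of weight `q` is a combination of the `b i`. Modes of
generators in `B` lengthen a monomial, the other `b i` act by scalars, and the `C₂(V)` part needs
only the shifts by weights below `q`. -/
theorem shifts_monomialFiltration (hCFT : A.IsCFTType) (hS : IsHomogeneousSystem g b wt α B)
    (q : ℤ) : T.Shifts (T.monomialFiltration b wt α B w) q := by
  have key : ∀ n : ℕ, ∀ q : ℤ, q < n → T.Shifts (T.monomialFiltration b wt α B w) q := by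
    intro n
    induction n with
    | zero => exact fun q hq => shifts_of_neg hCFT (by simpa using hq)
    | succ n ih =>
      intro q hq
      by_cases hq0 : q < 0
      · exact shifts_of_neg hCFT hq0
      intro u hu m p x hx
      obtain ⟨y, hy, z, hz, rfl⟩ := Submodule.mem_sup.1 (hS.weightSpace_le q hu)
      clear hu
      rw [map_add, Pi.add_apply, Pi.add_apply, LinearMap.add_apply]
      refine add_mem ?_ (monotone_monomialFiltration (show p + q - 1 ≤ p + q by omega)
        (act_C2Weight_mem hCFT monotone_monomialFiltration
          (fun q' hq' => ih q' (by omega)) hz m hx))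
      induction hy using Submodule.span_induction with
      | zero => simp
      | add u v _ _ hu hv =>
        rw [map_add, Pi.add_apply, Pi.add_apply, LinearMap.add_apply]
        exact add_mem hu hv
      | smul c u _ hu =>
        rw [map_smul, Pi.smul_apply, Pi.smul_apply, LinearMap.smul_apply]
        exact Submodule.smul_mem _ c hu
      | mem u hu =>
        obtain ⟨i, rfl, rfl⟩ := hu
        by_cases hi : i ∈ B
        · exact act_mem_monomialFiltration hS hi m hx
        · obtain ⟨c, hc⟩ := Submodule.mem_span_singleton.1 (hS.mem_span_vacuum i hi)
          rw [← hc, map_smul, Pi.smul_apply, Pi.smul_apply, LinearMap.smul_apply, T.identity]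
          refine Submodule.smul_mem _ c (monotone_monomialFiltration
            (show p ≤ p + wt i by omega) ?_)
          split_ifs
          · exact hx
          · simp
  exact key (q.toNat + 1) q (by omega)

theorem modeProd_apply_mem (hS : IsHomogeneousSystem g b wt α B) {s : List (I × ℤ)}
    (hs : ∀ q ∈ s, q.1 ∈ B) {p : ℤ} {x : W} (hx : x ∈ T.monomialFiltration b wt α B w p) :
    T.modeProd b α s x ∈ T.monomialFiltration b wt α B w (p + wtSum wt s) := by
  induction s with
  | nil => simpa using hx
  | cons q s ih =>
    rw [modeProd_cons, wtSum_cons, Module.End.mul_apply]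
    have := act_mem_monomialFiltration hS (hs q (by simp)) (α q.1 - q.2)
      (ih fun r hr => hs r (by simp [hr]))
    exact monotone_monomialFiltration (by omega) this

theorem commutator_mem_monomialFiltration (hCFT : A.IsCFTType)
    (hS : IsHomogeneousSystem g b wt α B) (i j : I) (n m : ℤ) {p : ℤ} {x : W}
    (hx : x ∈ T.monomialFiltration b wt α B w p) :
    T.act (b i) (α i - n) 0 (T.act (b j) (α j - m) 0 x) -
      T.act (b j) (α j - m) 0 (T.act (b i) (α i - n) 0 x) ∈
      T.monomialFiltration b wt α B w (p + wt i + wt j - 1) := by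
  have := commutator_mem hCFT monotone_monomialFiltration (shifts_monomialFiltration hCFT hS)
    (hS.mem_weightSpace i) (hS.mem_twistSpace i) (hS.mem_weightSpace j) (-n) (α j - m) hx
  simpa [← sub_eq_add_neg] using this

/-- Reordering a monomial changes it by an element of lower filtration degree. -/
theorem modeProd_perm_sub_mem (hCFT : A.IsCFTType) (hS : IsHomogeneousSystem g b wt α B)
    {s t : List (I × ℤ)} (h : s.Perm t) (hs : ∀ q ∈ s, q.1 ∈ B) {p : ℤ} {x : W}
    (hx : x ∈ T.monomialFiltration b wt α B w p) :
    T.modeProd b α s x - T.modeProd b α t x ∈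
      T.monomialFiltration b wt α B w (p + wtSum wt s - 1) := by
  induction h with
  | nil => simp
  | cons q h ih =>
    have := act_mem_monomialFiltration hS (hs q (by simp)) (α q.1 - q.2)
      (ih fun r hr => hs r (by simp [hr]))
    rw [map_sub] at this
    simp only [modeProd_cons, wtSum_cons, Module.End.mul_apply]
    exact monotone_monomialFiltration (by omega) this
  | swap q r l =>
    simp only [modeProd_cons, wtSum_cons, Module.End.mul_apply]
    have := commutator_mem_monomialFiltration hCFT hS r.1 q.1 r.2 q.2
      (modeProd_apply_mem hS (s := l) (fun r hr => hs r (by simp [hr])) hx)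
    exact monotone_monomialFiltration (by omega) this
  | trans h₁ h₂ ih₁ ih₂ =>
    have h2 := ih₂ fun q hq => hs q (h₁.mem_iff.2 hq)
    rw [← wtSum_perm wt h₁] at h2
    simpa using add_mem (ih₁ hs) h2

variable {L : ℤ}

/-- A mode annihilating `w` lowers the filtration degree. -/
theorem act_mem_of_le (hCFT : A.IsCFTType) (hS : IsHomogeneousSystem g b wt α B)
    (hL : ∀ i ∈ B, ∀ n : ℤ, n ≤ L → T.act (b i) (α i - n) 0 w = 0) {i : I} (hi : i ∈ B) {n : ℤ}
    (hn : n ≤ L) {p : ℤ} {x : W} (hx : x ∈ T.monomialFiltration b wt α B w p) :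
    T.act (b i) (α i - n) 0 x ∈ T.monomialFiltration b wt α B w (p + wt i - 1) := by
  have key : ∀ s : List (I × ℤ), (∀ q ∈ s, q.1 ∈ B) →
      T.act (b i) (α i - n) 0 (T.modeProd b α s w) ∈
        T.monomialFiltration b wt α B w (wtSum wt s + wt i - 1) := by
    intro s hs
    induction s with
    | nil => simp [hL i hi n hn]
    | cons q s ih =>
      have hs' : ∀ q ∈ s, q.1 ∈ B := fun r hr => hs r (by simp [hr])
      -- The mode is moved past the leftmost factor; the commutator already has lower degree.
      have h1 := commutator_mem_monomialFiltration hCFT hS i q.1 n q.2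
        (modeProd_mem_monomialFiltration (T := T) (b := b) (wt := wt) (α := α) (w := w) hs')
      have h2 := act_mem_monomialFiltration hS (hs q (by simp)) (α q.1 - q.2) (ih hs')
      rw [modeProd_cons, wtSum_cons, Module.End.mul_apply]
      simpa using add_mem
        (monotone_monomialFiltration (show wtSum wt s + wt i + wt q.1 - 1 ≤
          wt q.1 + wtSum wt s + wt i - 1 by omega) h1)
        (monotone_monomialFiltration (show wtSum wt s + wt i - 1 + wt q.1 ≤
          wt q.1 + wtSum wt s + wt i - 1 by omega) h2)
  induction hx using Submodule.span_induction with
  | zero => simp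
  | add x y _ _ hx hy => rw [map_add]; exact add_mem hx hy
  | smul c x _ hx => rw [map_smul]; exact Submodule.smul_mem _ c hx
  | mem x hx =>
    obtain ⟨s, hs, hle, rfl⟩ := hx
    exact monotone_monomialFiltration (by omega) (key s hs)

/-! ### Iterated products -/

variable (A b)

/-- The iterated product `(b_{i₁})₋₁ ⋯ (b_{iₖ})₋₁ 𝟏`. -/
def iterProd : ∀ k : ℕ, (Fin k → I) → V
  | 0, _ => A.vacuum
  | k + 1, i => A.mode (b (i 0)) (-1) (iterProd k (Fin.tail i))

variable {A} (α L)

/-- The highest index of a mode of the iterated product to which only the modes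
`bᵢ(αᵢ - n)` with `n > L` contribute. -/
def topIndex : ∀ k : ℕ, (Fin k → I) → ℂ
  -- The only nonzero mode of the vacuum has index `-1`; each further factor adds its own top index
  -- `αᵢ - (L + 1)` and the 1 from the indexing of the modes of `u₋₁v`.
  | 0, _ => -1
  | k + 1, i => α (i 0) + (-(L + 1) : ℤ) + topIndex k (Fin.tail i) + 1

variable {α L} {b}

theorem iterProd_mem_weightSpace (hS : IsHomogeneousSystem g b wt α B) (k : ℕ) (i : Fin k → I) :
    iterProd A b k i ∈ A.weightSpace (∑ t, wt (i t)) := by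
  induction k with
  | zero => simpa [iterProd] using A.vacuum_mem_weightSpace
  | succ k ih =>
    rw [Fin.sum_univ_succ]
    have := A.mode_mem_weightSpace (hS.mem_weightSpace (i 0)) (ih (Fin.tail i)) (-1)
    rwa [show ∀ a b : ℤ, a + b - -1 - 1 = a + b by intros; ring] at this

theorem lowersBelow_of_mem (hCFT : A.IsCFTType) (hS : IsHomogeneousSystem g b wt α B)
    (hL : ∀ i ∈ B, ∀ n : ℤ, n ≤ L → T.act (b i) (α i - n) 0 w = 0) {i : I} (hi : i ∈ B) :
    T.LowersBelow (T.monomialFiltration b wt α B w) (b i) (wt i) (α i + (-(L + 1) : ℤ)) := by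
  intro j hj p x hx
  have := act_mem_of_le hCFT hS hL hi (show L + 1 + j ≤ L by omega) hx
  rwa [show α i - ((L + 1 + j : ℤ) : ℂ) = α i + (-(L + 1) : ℤ) - j by push_cast; ring] at this

/-- Above the top index the convolution is empty, so only lower terms remain. -/
theorem lowersBelow_iterProd (hCFT : A.IsCFTType) (hS : IsHomogeneousSystem g b wt α B)
    (hL : ∀ i ∈ B, ∀ n : ℤ, n ≤ L → T.act (b i) (α i - n) 0 w = 0) (k : ℕ) (i : Fin k → I)
    (hi : ∀ t, i t ∈ B) :
    T.LowersBelow (T.monomialFiltration b wt α B w) (iterProd A b k i) (∑ t, wt (i t))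
      (topIndex α L k i) := by
  induction k with
  | zero =>
    intro j hj p x _
    rw [iterProd, topIndex, T.act_vacuum_of_ne]
    · simp
    · intro h
      have : (j : ℂ) = 0 := by linear_combination -h
      exact hj.ne (by exact_mod_cast this)
  | succ k ih =>
    intro j hj p x hx
    have := act_mode_neg_one_sub_mem hCFT monotone_monomialFiltration
      (shifts_monomialFiltration hCFT hS) (hS.mem_weightSpace (i 0)) (hS.mem_twistSpace (i 0))
      (iterProd_mem_weightSpace hS k (Fin.tail i)) (lowersBelow_of_mem hCFT hS hL (hi 0))
      (ih (Fin.tail i) fun t => hi t.succ) j hx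
    rw [show (j + 1).toNat = 0 by omega, Finset.sum_range_zero, sub_zero, add_assoc p] at this
    rwa [Fin.sum_univ_succ]

theorem sum_antidiagonalTuple_succ {M : Type*} [AddCommMonoid M] (k s : ℕ)
    (f : (Fin (k + 1) → ℕ) → M) :
    ∑ js ∈ Finset.Nat.antidiagonalTuple (k + 1) s, f js =
      ∑ j ∈ Finset.range (s + 1), ∑ js ∈ Finset.Nat.antidiagonalTuple k (s - j),
        f (Fin.cons j js) := by
  rw [Finset.sum_sigma']
  refine Finset.sum_bij' (fun js _ => ⟨js 0, Fin.tail js⟩) (fun p _ => Fin.cons p.1 p.2)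
    ?_ ?_ ?_ ?_ ?_
  · intro js hjs
    rw [Finset.Nat.mem_antidiagonalTuple, Fin.sum_univ_succ] at hjs
    simp only [Finset.mem_sigma, Finset.mem_range, Finset.Nat.mem_antidiagonalTuple, Fin.tail]
    omega
  · rintro ⟨j, js⟩ hjs
    simp only [Finset.mem_sigma, Finset.mem_range, Finset.Nat.mem_antidiagonalTuple] at hjs
    rw [Finset.Nat.mem_antidiagonalTuple, Fin.sum_univ_succ]
    simp only [Fin.cons_zero, Fin.cons_succ]
    omega
  · intro js _
    simp
  · intro p _
    simp
  · intro js _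
    simp

/-- The modes of an iterated product are the sums of the products of modes, up to lower filtration
degree. -/
theorem act_iterProd_sub_mem (hCFT : A.IsCFTType) (hS : IsHomogeneousSystem g b wt α B)
    (hL : ∀ i ∈ B, ∀ n : ℤ, n ≤ L → T.act (b i) (α i - n) 0 w = 0) (k : ℕ) (i : Fin k → I)
    (hi : ∀ t, i t ∈ B) (s : ℕ) {p : ℤ} {x : W} (hx : x ∈ T.monomialFiltration b wt α B w p) :
    T.act (iterProd A b k i) (topIndex α L k i - s) 0 x -
      ∑ js ∈ Finset.Nat.antidiagonalTuple k s,
        T.modeProd b α (List.ofFn fun t => (i t, L + 1 + (js t : ℤ))) x ∈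
      T.monomialFiltration b wt α B w (p + ∑ t, wt (i t) - 1) := by
  induction k generalizing s with
  | zero =>
    rw [iterProd, topIndex]
    rcases s with _ | s
    · simp [T.act_vacuum_neg_one]
    · rw [T.act_vacuum_of_ne]
      · simp
      · intro h
        have : ((s + 1 : ℕ) : ℂ) = 0 := by linear_combination -h
        exact s.succ_ne_zero (by exact_mod_cast this)
  | succ k ih =>
    have h1 := act_mode_neg_one_sub_mem hCFT monotone_monomialFiltration
      (shifts_monomialFiltration hCFT hS) (hS.mem_weightSpace (i 0)) (hS.mem_twistSpace (i 0))
      (iterProd_mem_weightSpace hS k (Fin.tail i)) (lowersBelow_of_mem hCFT hS hL (hi 0))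
      (lowersBelow_iterProd hCFT hS hL k (Fin.tail i) fun t => hi t.succ) s hx
    rw [show ((s : ℤ) + 1).toNat = s + 1 by omega, add_assoc p] at h1
    rw [Fin.sum_univ_succ, sum_antidiagonalTuple_succ]
    have h2 : ∀ j ∈ Finset.range (s + 1),
        T.act (b (i 0)) (α (i 0) + (-(L + 1) : ℤ) - j) 0 (T.act (iterProd A b k (Fin.tail i))
          (topIndex α L k (Fin.tail i) - ((s : ℤ) - j : ℤ)) 0 x) -
        ∑ js ∈ Finset.Nat.antidiagonalTuple k (s - j), T.modeProd b α
          (List.ofFn fun t => (i t, L + 1 + ((Fin.cons j js : Fin (k + 1) → ℕ) t : ℤ))) x ∈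
        T.monomialFiltration b wt α B w (p + (wt (i 0) + ∑ t, wt (Fin.tail i t)) - 1) := by
      intro j hj
      have hjs : j ≤ s := by
        rw [Finset.mem_range] at hj
        omega
      have h3 := act_mem_monomialFiltration hS (hi 0) (α (i 0) + (-(L + 1) : ℤ) - j)
        (ih (Fin.tail i) (fun t => hi t.succ) (s - j))
      rw [map_sub, map_sum] at h3
      rw [show ((s : ℤ) - j : ℤ) = ((s - j : ℕ) : ℤ) by omega, Int.cast_natCast]
      refine monotone_monomialFiltration
        (show p + ∑ t, wt (Fin.tail i t) - 1 + wt (i 0) ≤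
          p + (wt (i 0) + ∑ t, wt (Fin.tail i t)) - 1 by linarith) ?_
      convert h3 using 2
      refine Finset.sum_congr rfl fun js _ => ?_
      rw [List.ofFn_succ, modeProd_cons, Module.End.mul_apply]
      simp only [Fin.cons_zero, Fin.cons_succ]
      rw [show α (i 0) - ((L + 1 + (j : ℤ) : ℤ) : ℂ) = α (i 0) + (-(L + 1) : ℤ) - j by
        push_cast; ring]
      rfl
    have h4 := add_mem h1 (Submodule.sum_mem _ h2)
    rw [Finset.sum_sub_distrib, sub_add_sub_cancel] at h4
    exact h4

end WeakTwistedModule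

namespace WeakTwistedModule

variable {V : Type*} [AddCommGroup V] [Module ℂ V] {A : VertexOperatorAlgebra V}
  {g : A.Automorphism} {W : Type*} [AddCommGroup W] [Module ℂ W] {T : A.WeakTwistedModule g W}
  {I : Type*} {b : I → V} {wt : I → ℤ} {α : I → ℂ} {B : Set I} {w : W} {L : ℤ}

/-! ### Straightening monomials -/

/-- If a sum of `k` natural numbers equals `k j₀`, then its sum of squares exceeds `k j₀²` unless
all the numbers equal `j₀`. -/
theorem lt_sum_sq_of_ne {k j₀ : ℕ} {js : Fin k → ℕ} (h : ∑ t, js t = k * j₀)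
    (hne : js ≠ fun _ => j₀) : (k : ℤ) * (j₀ : ℤ) ^ 2 < ∑ t, (js t : ℤ) ^ 2 := by
  obtain ⟨t₀, ht₀⟩ := Function.ne_iff.1 hne
  have h1 : 0 < ∑ t, ((js t : ℤ) - j₀) ^ 2 :=
    Finset.sum_pos' (fun t _ => sq_nonneg _) ⟨t₀, Finset.mem_univ _, by
      have : (js t₀ : ℤ) - j₀ ≠ 0 := sub_ne_zero.2 (by exact_mod_cast ht₀)
      positivity⟩
  have h2 : ∑ t, (js t : ℤ) = k * j₀ := by exact_mod_cast h
  have h3 : ∑ t, ((js t : ℤ) - j₀) ^ 2 =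
      ∑ t, (js t : ℤ) ^ 2 - 2 * j₀ * ∑ t, (js t : ℤ) + k * (j₀ : ℤ) ^ 2 := by
    simp only [sub_sq, Finset.sum_add_distrib, Finset.sum_sub_distrib, Finset.mul_sum]
    simp only [Finset.sum_const, Finset.card_univ, Fintype.card_fin, nsmul_eq_mul]
    congr 2
    exact Finset.sum_congr rfl fun t _ => by ring
  rw [h2] at h3
  linarith

/-- Bounds the sum of squares of the shifted indices by a quantity that straightening does not
change, which makes the descent stop. -/
theorem sum_sq_le_sq_sum_of_nonneg {l : List ℤ} (h : ∀ x ∈ l, 0 ≤ x) :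
    (l.map (· ^ 2)).sum ≤ l.sum ^ 2 := by
  induction l with
  | nil => simp
  | cons a l ih =>
    have h1 := ih fun x hx => h x (by simp [hx])
    have h2 := h a (by simp)
    have h3 : 0 ≤ l.sum := List.sum_nonneg fun x hx => h x (by simp [hx])
    simp only [List.map_cons, List.sum_cons]
    nlinarith [mul_nonneg h2 h3]

/-- The sum of all products of modes of `k ≥ M` given generators with a fixed sum of indices lowers
the filtration degree. -/
theorem sum_modeProd_mem (hCFT : A.IsCFTType) (hS : IsHomogeneousSystem g b wt α B)
    (hL : ∀ i ∈ B, ∀ n : ℤ, n ≤ L → T.act (b i) (α i - n) 0 w = 0) {M : ℕ}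
    (hM : ∀ n : ℤ, (M : ℤ) ≤ n → A.weightSpace n ≤ A.C2) {k : ℕ} (hk : M ≤ k) (i : Fin k → I)
    (hi : ∀ t, i t ∈ B) (s : ℕ) {p : ℤ} {x : W} (hx : x ∈ T.monomialFiltration b wt α B w p) :
    ∑ js ∈ Finset.Nat.antidiagonalTuple k s,
        T.modeProd b α (List.ofFn fun t => (i t, L + 1 + (js t : ℤ))) x ∈
      T.monomialFiltration b wt α B w (p + ∑ t, wt (i t) - 1) := by
  -- Each generator in `B` has weight at least 1, so the iterated product has weight at least `k ≥
  -- M` and lies in `C₂(V)`.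
  have hwt : (M : ℤ) ≤ ∑ t, wt (i t) := by
    have : ∑ _t : Fin k, (1 : ℤ) ≤ ∑ t, wt (i t) :=
      Finset.sum_le_sum fun t _ => hS.one_le _ (hi t)
    simp only [Finset.sum_const, Finset.card_univ, Fintype.card_fin, nsmul_eq_mul, mul_one] at this
    omega
  have h1 := act_C2Weight_mem hCFT monotone_monomialFiltration
    (fun q _ => shifts_monomialFiltration hCFT hS q)
    (weightSpace_le_C2Weight g (hM _ hwt) (iterProd_mem_weightSpace hS k i))
    (topIndex α L k i - s) hx
  have h2 := act_iterProd_sub_mem hCFT hS hL k i hi s hx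
  simpa using sub_mem h1 h2

/-- If more than `M` entries of a list have second component `n`, then `M + 1` of them can be moved
to the front. -/
theorem exists_perm_ofFn_append (s : List (I × ℤ)) (n : ℤ) (M : ℕ)
    (h : M < (s.map Prod.snd).count n) :
    ∃ (i : Fin (M + 1) → I) (t : List (I × ℤ)), s.Perm ((List.ofFn fun j => (i j, n)) ++ t) := by
  have h1 : ((s.filter (·.2 = n)).take (M + 1)).length = M + 1 := by
    rw [List.count_eq_countP, List.countP_map, List.countP_eq_length_filter] at h
    rw [List.length_take, min_eq_left]
    simp only [beq_eq_decide] at h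
    exact h
  set t := (s.filter (·.2 = n)).take (M + 1) with ht
  refine ⟨fun j => (t.get (j.cast h1.symm)).1,
    (s.filter (·.2 = n)).drop (M + 1) ++ s.filter (fun x => ¬ (x.2 = n)), ?_⟩
  have h2 : (List.ofFn fun j : Fin (M + 1) => ((t.get (j.cast h1.symm)).1, n)) = t := by
    refine List.ext_getElem (by simp [h1]) fun j hj hj' => ?_
    have h3 : t[j] ∈ s.filter (·.2 = n) := List.mem_of_mem_take (List.getElem_mem hj')
    rw [List.mem_filter] at h3
    have h4 : t[j].2 = n := by simpa using h3.2
    simp only [List.getElem_ofFn, List.get_eq_getElem, Fin.val_cast]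
    exact Prod.ext rfl h4.symm
  rw [h2, ← List.append_assoc, List.take_append_drop]
  simpa using (List.filter_append_perm (fun x : I × ℤ => decide (x.2 = n)) s).symm

/-- The span of the ordered monomials with indices above `L`, in which each index occurs at most
`M` times. -/
def orderedSpan (T : A.WeakTwistedModule g W) (b : I → V) (α : I → ℂ) (B : Set I) (w : W) (L : ℤ)
    (M : ℕ) : Submodule ℂ W :=
  Submodule.span ℂ {x : W | ∃ s : List (I × ℤ), (∀ p ∈ s, p.1 ∈ B ∧ L < p.2) ∧
    (s.map Prod.snd).Pairwise (· ≥ ·) ∧ (∀ n, (s.map Prod.snd).count n ≤ M) ∧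
    x = T.modeProd b α s w}

/-- A monomial with indices above `L` is a combination of ordered monomials. -/
theorem modeProd_mem_orderedSpan (hCFT : A.IsCFTType) (hS : IsHomogeneousSystem g b wt α B)
    (hL : ∀ i ∈ B, ∀ n : ℤ, n ≤ L → T.act (b i) (α i - n) 0 w = 0) {M : ℕ}
    (hM : ∀ n : ℤ, (M : ℤ) ≤ n → A.weightSpace n ≤ A.C2) {p : ℤ}
    (hp : T.monomialFiltration b wt α B w (p - 1) ≤ orderedSpan T b α B w L M) (d : ℕ)
    (s : List (I × ℤ)) (hs : ∀ q ∈ s, q.1 ∈ B ∧ L < q.2) (hsp : wtSum wt s = p)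
    (hd : (s.map fun q => q.2 - L - 1).sum ^ 2 <
      (s.map fun q => (q.2 - L - 1) ^ 2).sum + d) :
    T.modeProd b α s w ∈ orderedSpan T b α B w L M := by
  have hw : w ∈ T.monomialFiltration b wt α B w 0 :=
    modeProd_mem_monomialFiltration (T := T) (b := b) (α := α) (s := []) (by simp)
  have hperm : ∀ {s t : List (I × ℤ)}, s.Perm t → (∀ q ∈ s, q.1 ∈ B ∧ L < q.2) →
      wtSum wt s = p → T.modeProd b α t w ∈ orderedSpan T b α B w L M →
      T.modeProd b α s w ∈ orderedSpan T b α B w L M := by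
    intro s t hst hs hsp ht
    have := modeProd_perm_sub_mem hCFT hS hst (fun q hq => (hs q hq).1) hw
    rw [zero_add, hsp] at this
    simpa using add_mem (hp this) ht
  -- `d` exceeds the gap between the squared sum and the sum of squares of the shifted indices. The
  -- gap is nonnegative, so `d = 0` is impossible.
  induction d generalizing s with
  | zero =>
    have := sum_sq_le_sq_sum_of_nonneg (l := s.map fun q => q.2 - L - 1) (by
      intro x hx
      obtain ⟨q, hq, rfl⟩ := List.mem_map.1 hx
      have := (hs q hq).2
      omega)
    rw [List.map_map] at this
    simp only [Nat.cast_zero, add_zero] at hd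
    exact absurd hd (not_lt.2 this)
  | succ d ih =>
    by_cases hc : ∀ n, (s.map Prod.snd).count n ≤ M
    · set t := s.mergeSort (fun x y => decide (y.2 ≤ x.2)) with ht
      have hst : t.Perm s := List.mergeSort_perm _ _
      refine hperm hst.symm hs hsp (Submodule.subset_span ⟨t, fun q hq => hs q (hst.mem_iff.1 hq),
        ?_, fun n => ((hst.map _).count_eq n).trans_le (hc n), rfl⟩)
      rw [List.pairwise_map]
      have := List.pairwise_mergeSort (le := fun x y : I × ℤ => decide (y.2 ≤ x.2))
        (fun a b c h1 h2 => by
          simp only [decide_eq_true_eq] at *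
          omega)
        (fun a b => by
          simp only [Bool.or_eq_true, decide_eq_true_eq]
          omega) s
      simpa using this
    · push Not at hc
      obtain ⟨n, hn⟩ := hc
      obtain ⟨i, r, hir⟩ := exists_perm_ofFn_append s n M hn
      have hs' := fun q hq => hs q (hir.mem_iff.2 hq)
      have hi : ∀ t, i t ∈ B := fun t =>
        (hs' (i t, n) (List.mem_append_left _ (List.mem_ofFn.2 ⟨t, rfl⟩))).1
      have hn : L < n := (hs' (i 0, n) (List.mem_append_left _ (List.mem_ofFn.2 ⟨0, rfl⟩))).2
      obtain ⟨j₀, rfl⟩ : ∃ j₀ : ℕ, n = L + 1 + j₀ := ⟨(n - L - 1).toNat, by omega⟩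
      have hwt : ∀ js : Fin (M + 1) → ℕ,
          wtSum wt (List.ofFn fun t => (i t, L + 1 + (js t : ℤ))) = ∑ t, wt (i t) := fun js => by
        rw [wtSum, List.map_ofFn, List.sum_ofFn]
        rfl
      have hr : ∀ q ∈ r, q.1 ∈ B ∧ L < q.2 := fun q hq => hs' q (List.mem_append_right _ hq)
      have hpr : wtSum wt r + ∑ t, wt (i t) = p := by
        rw [← hsp, wtSum_perm wt hir, wtSum_append, ← hwt fun _ => j₀, add_comm]
      -- The total `(M + 1) * j₀` makes the constant tuple `j₀` one of the summands; solving the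
      -- relation for it leaves tuples with a strictly larger sum of squares.
      have hsum := sum_modeProd_mem hCFT hS hL hM M.le_succ i hi ((M + 1) * j₀)
        (modeProd_mem_monomialFiltration (T := T) (b := b) (wt := wt) (α := α) (w := w)
          fun q hq => (hr q hq).1)
      rw [hpr] at hsum
      have hj₀ : (fun _ => j₀) ∈ Finset.Nat.antidiagonalTuple (M + 1) ((M + 1) * j₀) := by
        simp [Finset.Nat.mem_antidiagonalTuple]
      rw [← Finset.add_sum_erase _ _ hj₀] at hsum
      refine hperm hir hs hsp ?_
      rw [modeProd_append, Module.End.mul_apply]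
      refine (Submodule.add_mem_iff_left _ (Submodule.sum_mem _ fun js hjs => ?_)).1 (hp hsum)
      obtain ⟨hne, hmem⟩ := Finset.mem_erase.1 hjs
      rw [Finset.Nat.mem_antidiagonalTuple] at hmem
      rw [← Module.End.mul_apply, ← modeProd_append]
      refine ih _ ?_ ?_ ?_
      · intro q hq
        rcases List.mem_append.1 hq with hq | hq
        · obtain ⟨t, rfl⟩ := List.mem_ofFn.1 hq
          exact ⟨hi t, by simp only; omega⟩
        · exact hr q hq
      · rw [wtSum_append, hwt, add_comm, hpr]
      · have h1 := lt_sum_sq_of_ne hmem hne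
        have h2 : ∑ t, (js t : ℤ) = (M + 1) * j₀ := by exact_mod_cast hmem
        have e1 := (hir.map fun q => q.2 - L - 1).sum_eq
        have e2 := (hir.map fun q => (q.2 - L - 1) ^ 2).sum_eq
        rw [e1, e2] at hd
        simp only [List.map_append, List.map_ofFn, List.sum_append, List.sum_ofFn,
          Function.comp_apply] at hd ⊢
        have e3 : ∀ j : ℤ, L + 1 + j - L - 1 = j := fun j => by ring
        simp only [e3, h2, Finset.sum_const, Finset.card_univ, Fintype.card_fin,
          nsmul_eq_mul] at hd ⊢
        push_cast at hd h1 ⊢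
        linarith

/-- Induction on `p`, starting from negative `p`, where there are no monomials because weights in
`B` are positive. -/
theorem monomialFiltration_le_orderedSpan (hCFT : A.IsCFTType)
    (hS : IsHomogeneousSystem g b wt α B)
    (hL : ∀ i ∈ B, ∀ n : ℤ, n ≤ L → T.act (b i) (α i - n) 0 w = 0) {M : ℕ}
    (hM : ∀ n : ℤ, (M : ℤ) ≤ n → A.weightSpace n ≤ A.C2) (p : ℤ) :
    T.monomialFiltration b wt α B w p ≤ orderedSpan T b α B w L M := by
  have key : ∀ n : ℕ, ∀ p : ℤ, p < n →
      T.monomialFiltration b wt α B w p ≤ orderedSpan T b α B w L M := by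
    intro n
    induction n with
    | zero =>
      intro p hp
      refine Submodule.span_le.2 ?_
      rintro _ ⟨s, hs, hle, rfl⟩
      have : 0 ≤ wtSum wt s := List.sum_nonneg fun x hx => by
        obtain ⟨q, hq, rfl⟩ := List.mem_map.1 hx
        exact zero_le_one.trans (hS.one_le _ (hs q hq))
      push_cast at hp
      omega
    | succ n ih =>
      intro p hp
      refine Submodule.span_le.2 ?_
      rintro _ ⟨s, hs, hle, rfl⟩
      have hlow := ih (wtSum wt s - 1) (by push_cast at hp; omega)
      by_cases hsL : ∀ q ∈ s, L < q.2
      · refine modeProd_mem_orderedSpan hCFT hS hL hM hlow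
          ((s.map fun q : I × ℤ => q.2 - L - 1).sum ^ 2 + 1).toNat s
          (fun q hq => ⟨hs q hq, hsL q hq⟩) rfl ?_
        have h1 : 0 ≤ (s.map fun q => (q.2 - L - 1) ^ 2).sum := List.sum_nonneg fun x hx => by
          obtain ⟨q, hq, rfl⟩ := List.mem_map.1 hx
          exact sq_nonneg _
        rw [Int.toNat_of_nonneg (by positivity)]
        linarith
      · push Not at hsL
        obtain ⟨q, hq, hqL⟩ := hsL
        classical
        -- A factor of index at most `L` is brought to the front, where it lowers the degree; the
        -- whole monomial is then covered by induction.
        have hperm := List.perm_cons_erase hq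
        have hw : w ∈ T.monomialFiltration b wt α B w 0 :=
          modeProd_mem_monomialFiltration (T := T) (b := b) (α := α) (s := []) (by simp)
        have h1 := modeProd_perm_sub_mem hCFT hS hperm hs hw
        have h2 := act_mem_of_le hCFT hS hL (hs q hq) hqL
          (modeProd_mem_monomialFiltration (T := T) (b := b) (wt := wt) (α := α) (w := w)
            (s := s.erase q) fun r hr => hs r (List.mem_of_mem_erase hr))
        rw [add_comm _ (wt q.1), ← wtSum_cons, ← wtSum_perm wt hperm] at h2
        rw [zero_add, modeProd_cons, Module.End.mul_apply] at h1
        have := add_mem h1 h2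
        rw [sub_add_cancel] at this
        exact hlow this
  exact key (p.toNat + 1) p (by omega)

/-! ### Exhaustion of `W` and conclusion -/

/-- The filtration by weight exhausts a module generated by `w`. -/
theorem iSup_monomialFiltration (hCFT : A.IsCFTType) (hS : IsHomogeneousSystem g b wt α B)
    (hw : T.IsGeneratedBy w) : ⨆ p, T.monomialFiltration b wt α B w p = ⊤ := by
  have hact : ∀ (u : V) (n : ℂ) (k : ℕ), ∀ x ∈ ⨆ p, T.monomialFiltration b wt α B w p,
      T.act u n k x ∈ ⨆ p, T.monomialFiltration b wt α B w p := by
    intro u n k x hx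
    have h : (⨆ p, T.monomialFiltration b wt α B w p) ≤
        (⨆ p, T.monomialFiltration b wt α B w p).comap (T.act u n k) := by
      refine iSup_le fun p x hx => ?_
      rw [Submodule.mem_comap]
      have hu : u ∈ ⨆ q, ⨆ β, A.weightSpace q ⊓ g.twistSpace β := by
        rw [g.iSup_inf_twistSpace]; trivial
      have h2 : (⨆ q, ⨆ β, A.weightSpace q ⊓ g.twistSpace β) ≤
          (⨆ p, T.monomialFiltration b wt α B w p).comap
            ((LinearMap.proj k ∘ₗ LinearMap.proj n ∘ₗ T.act : V →ₗ[ℂ] Module.End ℂ W).flip x) := by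
        refine iSup_le fun q => iSup_le fun β u hu => ?_
        change T.act u n k x ∈ ⨆ p, T.monomialFiltration b wt α B w p
        by_cases hn : ∃ r : ℤ, n = β + r
        · obtain ⟨r, rfl⟩ := hn
          -- Coefficients of powers of the logarithm are log-free modes of `(-𝓝)ᵏu/k!`, which has
          -- the weight of `u`.
          rw [T.act_log hu.2]
          refine Submodule.mem_iSup_of_mem (p + q)
            (shifts_monomialFiltration hCFT hS q _ (Submodule.smul_mem _ _ ?_) _ p x hx)
          induction k with
          | zero => exact hu.1
          | succ k ih =>
            rw [pow_succ', Module.End.mul_apply, LinearMap.neg_apply]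
            exact neg_mem (g.N_mem_weightSpace ih)
        · push Not at hn
          rw [T.act_eq_zero hu.2 hn]
          simp
      exact h2 hu
    exact h hx
  have hgen : ∀ f ∈ T.modeAlgebra, ∀ x ∈ ⨆ p, T.monomialFiltration b wt α B w p,
      f x ∈ ⨆ p, T.monomialFiltration b wt α B w p := by
    intro f hf
    induction hf using Algebra.adjoin_induction with
    | mem f hf =>
      obtain ⟨u, n, k, rfl⟩ := hf
      exact hact u n k
    | algebraMap c => exact fun x hx => Submodule.smul_mem _ c hx
    | add f f' _ _ h h' => exact fun x hx => add_mem (h x hx) (h' x hx)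
    | mul f f' _ _ h h' => exact fun x hx => h _ (h' x hx)
  rw [eq_top_iff]
  intro x _
  obtain ⟨f, hf, rfl⟩ := hw x
  exact hgen f hf w (Submodule.mem_iSup_of_mem 0
    (modeProd_mem_monomialFiltration (T := T) (b := b) (α := α) (s := []) (by simp)))

end WeakTwistedModule

/-- CFT type enters through the bound on weights: a `b i` of weight at most 0 is a multiple of the
vacuum. -/
theorem isHomogeneousSystem {V : Type*} [AddCommGroup V] [Module ℂ V]
    {A : VertexOperatorAlgebra V} (hCFT : A.IsCFTType) (g : A.Automorphism) {I : Type*}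
    (e : Module.Basis I ℂ (V ⧸ A.C2)) {b : I → V} {wt : I → ℤ} {α : I → ℂ}
    (hb : ∀ i, A.C2.mkQ (b i) = e i) (hwt : ∀ i, b i ∈ A.weightSpace (wt i))
    (hα : ∀ i, b i ∈ g.twistSpace (α i)) :
    IsHomogeneousSystem g b wt α {i | b i ∉ Submodule.span ℂ {A.vacuum}} where
  weightSpace_le := weightSpace_le_span_sup_C2Weight g e hb hwt
  mem_weightSpace := hwt
  mem_twistSpace := hα
  one_le i hi := by
    by_contra hlt
    refine hi ?_
    have h := hwt i
    rcases (show wt i < 0 ∨ wt i = 0 by omega) with h0 | h0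
    · rw [hCFT.1 _ h0, Submodule.mem_bot] at h
      rw [h]
      exact zero_mem _
    · rwa [h0, hCFT.2] at h
  mem_span_vacuum i hi := not_not.1 hi

end VertexOperatorAlgebra

end

theorem mainTheorem2 {V : Type*} [AddCommGroup V] [Module ℂ V] (A : VertexOperatorAlgebra V)
    (hC2 : A.IsC2Cofinite) (hCFT : A.IsCFTType) (g : A.Automorphism)
    {W : Type*} [AddCommGroup W] [Module ℂ W] (T : A.WeakTwistedModule g W)
    (w : W) (hw : T.IsGeneratedBy w)
    -- homogeneous representatives `b i` of a basis of `V / C₂(V)`, with `𝓢`-eigenvalues `α i`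
    {I : Type*} (e : Module.Basis I ℂ (V ⧸ A.C2)) (b : I → V) (wt : I → ℤ) (α : I → ℂ)
    (hb : ∀ i, A.C2.mkQ (b i) = e i)
    (hwt : ∀ i, b i ∈ A.weightSpace (wt i)) (hα : ∀ i, b i ∈ g.twistSpace (α i))
    -- `B` consists of the `b i` that are not multiples of the vacuum vector
    (B : Set I) (hB : B = {i | b i ∉ Submodule.span ℂ {A.vacuum}})
    (L : ℤ) (hL : ∀ i ∈ B, ∀ n : ℤ, n ≤ L → T.act (b i) (α i - n) 0 w = 0)
    (M : ℕ) (hM : ∀ n : ℤ, (M : ℤ) ≤ n → A.weightSpace n ≤ A.C2)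
    (N : ℤ) (hN : L ≤ N) :
    Submodule.span ℂ {x : W | ∃ s : List (I × ℤ),
      (∀ p ∈ s, p.1 ∈ B ∧ L < p.2) ∧
      (s.map Prod.snd).Pairwise (· ≥ ·) ∧
      (∀ n ≤ N, (s.map Prod.snd).count n ≤ M) ∧
      x = (s.map fun p => T.act (b p.1) (α p.1 - p.2) 0).prod w} = ⊤ := by
  have hS := VertexOperatorAlgebra.isHomogeneousSystem hCFT g e hb hwt hα
  subst hB
  rw [eq_top_iff, ← VertexOperatorAlgebra.WeakTwistedModule.iSup_monomialFiltration hCFT hS hw]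
  refine iSup_le fun p => (VertexOperatorAlgebra.WeakTwistedModule.monomialFiltration_le_orderedSpan
    hCFT hS hL hM p).trans (Submodule.span_mono ?_)
  rintro x ⟨s, hs, hord, hcount, rfl⟩
  exact ⟨s, hs, hord, fun n _ => hcount n, rfl⟩
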